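/- Let $k$ be a field of characteristic zero, $L=k(t)$, $\mathbf x=(x_0,\dots,x_n)$, and let $f\in L[\mathbf x]$ be homogeneous of degree $d$ such that $L[\mathbf x]/(\partial_0f,\dots,\partial_nf)$ is finite-dimensional over $L$, where $\partial_i=\partial/\partial x_i$. Let $L[\mathbf x,\frac1f]_{p}$ be the space of rational functions that are homogeneous of degree $p$ in $\mathbf x$ and have a power of $f$ as denominator, and let $D_f$ be the set of all $\sum_{i=0}^n\partial_iA_i$ with $A_0,\dots,A_n\in L[\mathbf x,\frac1f]_{-n}$. Let $F\in L[\mathbf x,\frac1f]_{-n-1}$. A nonzero operator $T=\sum_j c_j\partial_t^j\in L\langle\partial_t\rangle$ is a *telescoper of $F$ with regular certificate* if $T(F)=\sum_{i=0}^n\partial_iA_i$ for some $A_0,\dots,A_n\in L(\mathbf x)$ such that every irreducible factor in $L[\mathbf x]$ of the denominator of an $A_i$ divides the denominator of $F$ (all fractions in lowest terms). Fix a monomial order and a Gröbner basis $B$ of the Jacobian ideal $(\partial_0f,\dots,\partial_nf)$. Given $G=a/f^\ell\in L[\mathbf x,\frac1f]_{-n-1}$ with $\ell\ge1$, the procedure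 $\mathrm{Reduce}(a/f^\ell)$ returns $a/f$ if $\ell=1$; if $\ell>1$ it decomposes $a=r+\sum_iv_i\partial_if$, where $r$ is the normal form of $a$ with respect to $B$ and $r$ and the $v_i$ are homogeneous with every nonzero term of the sum of degree $\deg a$, and returns $\frac r{f^\ell}+\mathrm{Reduce}\bigl(\frac1{\ell-1}\sum_i\frac{\partial_iv_i}{f^{\ell-1}}\bigr)$. Algorithm Telesc computes $G_0=\mathrm{Reduce}(F)$ and then, for $i=0,1,2,\dots$: if $\operatorname{rank}_L(G_0,\dots,G_i)<i+1$, it solves $\sum_{j<i}a_jG_j=G_i$ for $a_0,\dots,a_{i-1}\in L$ and returns $\partial_t^i-\sum_{j<i}a_j\partial_t^j$; otherwise it sets $G_{i+1}=\mathrm{Reduce}(\partial_tG_i)$ and continues. **Proposition.** Whatever the choices left open above (the way of writing an element of $L[\mathbf x,\frac1f]_{-n-1}$ as $a/f^\ell$ and the cofactors $v_i$), Algorithm Telesc terminates on input $F$: no execution is infinite, and none stops before returning an operator. Every returned operator $T$ is the minimal telescoper of $F$ with regular certificate: it is a telescoper of $F$ with regular certificate, of least order among these, its leading coefficient is $1$,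 and every telescoper of $F$ with regular certificate of the same order is of the form $cT$ with $c\in L$. Moreover $T(F)\in D_f$, and $T$ has least order among the nonzero operators $S\in L\langle\partial_t\rangle$ with $S(F)\in D_f$. -/

import Mathlib

open MvPolynomial

noncomputable section

namespace Telescoping

/-! ### Derivations of rational functions -/

section Derivations

variable {S R K : Type*} [CommRing S] [CommRing R] [IsDomain R] [Algebra S R] [Field K]
  [Algebra R K] [IsFractionRing R K]

/-- The quotient rule `(b D(a) - a D(b)) / b ^ 2` for a chosen way of writing `x = a / b`. -/
def quotientRule (D : Derivation S R R) (x : K) : K :=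
  let a : R := (IsLocalization.sec (nonZeroDivisors R) x).1
  let b : R := ((IsLocalization.sec (nonZeroDivisors R) x).2 : R)
  (algebraMap R K b * algebraMap R K (D a) - algebraMap R K a * algebraMap R K (D b)) /
    algebraMap R K b ^ 2

/-- The quotient rule does not depend on the fraction chosen. -/
theorem quotientRule_div (D : Derivation S R R) (a b : R) (hb : b ≠ 0) :
    quotientRule D (algebraMap R K a / algebraMap R K b) =
      (algebraMap R K b * algebraMap R K (D a) - algebraMap R K a * algebraMap R K (D b)) /
        algebraMap R K b ^ 2 := by
  have inj : Function.Injective (algebraMap R K) := IsFractionRing.injective R K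
  have hs := IsLocalization.sec_spec (nonZeroDivisors R)
    (algebraMap R K a / algebraMap R K b)
  have hv := nonZeroDivisors.coe_ne_zero
    (IsLocalization.sec (nonZeroDivisors R) (algebraMap R K a / algebraMap R K b)).2
  unfold quotientRule
  generalize IsLocalization.sec (nonZeroDivisors R) (algebraMap R K a / algebraMap R K b) = w
    at hs hv ⊢
  obtain ⟨u, v⟩ := w
  simp only at hs hv ⊢
  have hbK : algebraMap R K b ≠ 0 := fun h0 => hb (inj (h0.trans (map_zero _).symm))
  have hvK : algebraMap R K (v : R) ≠ 0 := fun h0 => hv (inj (by simpa using h0))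
  have hav : a * (v : R) = u * b := by
    apply inj
    rw [map_mul, map_mul, ← hs]
    field_simp
  have hD : a * D (v : R) + (v : R) * D a = u * D b + b * D u := by
    have := congrArg D hav
    simpa [Derivation.leibniz, smul_eq_mul] using this
  have e1 := congrArg (algebraMap R K) hav
  have e2 := congrArg (algebraMap R K) hD
  simp only [map_mul, map_add] at e1 e2
  rw [div_eq_div_iff (pow_ne_zero 2 hvK) (pow_ne_zero 2 hbK)]
  linear_combination (-(algebraMap R K b) * algebraMap R K (v : R)) * e2
    + (algebraMap R K b * algebraMap R K (D (v : R))
      + algebraMap R K (v : R) * algebraMap R K (D b)) * e1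

variable [Algebra S K] [IsScalarTower S R K]

variable (K) in
/-- The unique extension of a derivation of a domain to its field of fractions. -/
def extendDerivation (D : Derivation S R R) : Derivation S K K :=
  Derivation.mk'
    { toFun := quotientRule D
      map_add' := by
        intro x y
        obtain ⟨a, b, hb, rfl⟩ := IsFractionRing.div_surjective (A := R) x
        obtain ⟨a', b', hb', rfl⟩ := IsFractionRing.div_surjective (A := R) y
        have inj : Function.Injective (algebraMap R K) := IsFractionRing.injective R K
        have hb0 := nonZeroDivisors.ne_zero hb
        have hb0' := nonZeroDivisors.ne_zero hb'
        have hbK : algebraMap R K b ≠ 0 := fun h0 => hb0 (inj (by simpa using h0))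
        have hbK' : algebraMap R K b' ≠ 0 := fun h0 => hb0' (inj (by simpa using h0))
        have e : algebraMap R K a / algebraMap R K b + algebraMap R K a' / algebraMap R K b' =
            algebraMap R K (a * b' + b * a') / algebraMap R K (b * b') := by
          simp only [map_add, map_mul]
          field_simp
        rw [e, quotientRule_div D _ _ (mul_ne_zero hb0 hb0'), quotientRule_div D _ _ hb0,
          quotientRule_div D _ _ hb0']
        simp only [map_add, map_mul, Derivation.leibniz, smul_eq_mul]
        field_simp
        ring
      map_smul' := by
        intro c x
        obtain ⟨a, b, hb, rfl⟩ := IsFractionRing.div_surjective (A := R) x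
        have hb0 := nonZeroDivisors.ne_zero hb
        have e : c • (algebraMap R K a / algebraMap R K b) =
            algebraMap R K (c • a) / algebraMap R K b := by
          rw [Algebra.algebraMap_eq_smul_one (c • a), smul_assoc, ← Algebra.algebraMap_eq_smul_one,
            div_eq_mul_inv, div_eq_mul_inv, smul_mul_assoc]
        have e' : ∀ y : R, algebraMap R K (c • y) = c • algebraMap R K y := by
          intro y
          rw [Algebra.algebraMap_eq_smul_one (c • y), smul_assoc, ← Algebra.algebraMap_eq_smul_one]
        rw [e, quotientRule_div D _ _ hb0, quotientRule_div D _ _ hb0, Derivation.map_smul, e', e']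
        simp only [RingHom.id_apply, div_eq_mul_inv, mul_smul_comm, smul_mul_assoc, ← smul_sub] }
    (by
      intro x y
      obtain ⟨a, b, hb, rfl⟩ := IsFractionRing.div_surjective (A := R) x
      obtain ⟨a', b', hb', rfl⟩ := IsFractionRing.div_surjective (A := R) y
      have inj : Function.Injective (algebraMap R K) := IsFractionRing.injective R K
      have hb0 := nonZeroDivisors.ne_zero hb
      have hb0' := nonZeroDivisors.ne_zero hb'
      have hbK : algebraMap R K b ≠ 0 := fun h0 => hb0 (inj (by simpa using h0))
      have hbK' : algebraMap R K b' ≠ 0 := fun h0 => hb0' (inj (by simpa using h0))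
      have e : algebraMap R K a / algebraMap R K b * (algebraMap R K a' / algebraMap R K b') =
          algebraMap R K (a * a') / algebraMap R K (b * b') := by
        simp only [map_mul]
        field_simp
      simp only [LinearMap.coe_mk, AddHom.coe_mk, smul_eq_mul]
      rw [e, quotientRule_div D _ _ (mul_ne_zero hb0 hb0'), quotientRule_div D _ _ hb0,
        quotientRule_div D _ _ hb0']
      simp only [map_add, map_mul, Derivation.leibniz, smul_eq_mul]
      field_simp
      ring)

/-- The extension of a derivation to the field of fractions obeys the quotient rule. -/
theorem extendDerivation_div (D : Derivation S R R) (a b : R) (hb : b ≠ 0) :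
    extendDerivation K D (algebraMap R K a / algebraMap R K b) =
      (algebraMap R K b * algebraMap R K (D a) - algebraMap R K a * algebraMap R K (D b)) /
        algebraMap R K b ^ 2 :=
  quotientRule_div D a b hb

/-- A derivation of the coefficient ring, applied to the coefficients of a polynomial. -/
def coeffMap {σ R : Type*} [CommRing R] [Algebra S R] (D : Derivation S R R)
    (p : MvPolynomial σ R) : MvPolynomial σ R :=
  ∑ u ∈ p.support, monomial u (D (coeff u p))

theorem coeff_coeffMap {σ R : Type*} [CommRing R] [Algebra S R] (D : Derivation S R R)
    (p : MvPolynomial σ R) (s : σ →₀ ℕ) : coeff s (coeffMap D p) = D (coeff s p) := by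
  classical
  simp only [coeffMap, coeff_sum, coeff_monomial]
  rw [Finset.sum_ite_eq' p.support s]
  split_ifs with h
  · rfl
  · rw [notMem_support_iff.1 h, map_zero]

/-- `coeffMap` as a derivation of the polynomial ring. -/
def coeffDerivation {σ R : Type*} [CommRing R] [Algebra S R] (D : Derivation S R R) :
    Derivation S (MvPolynomial σ R) (MvPolynomial σ R) :=
  Derivation.mk'
    { toFun := coeffMap D
      map_add' := by
        intro p q
        ext s
        simp only [coeff_coeffMap, coeff_add, map_add]
      map_smul' := by
        intro c p
        ext s
        simp only [coeff_coeffMap, coeff_smul, Derivation.map_smul, RingHom.id_apply] }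
    (by
      classical
      intro p q
      ext s
      simp only [LinearMap.coe_mk, AddHom.coe_mk, smul_eq_mul, coeff_coeffMap, coeff_add]
      rw [mul_comm q]
      simp only [coeff_mul, coeff_coeffMap, map_sum, Derivation.leibniz, smul_eq_mul,
        Finset.sum_add_distrib]
      congr 1
      exact Finset.sum_congr rfl fun _ _ => mul_comm _ _)

end Derivations

/-! ### The rings `L[x₀, …, xₙ]` and `L(x₀, …, xₙ)` with `L = k(t)` -/

/-- `L[x₀, …, xₙ]`, where `L = k(t)`. -/
abbrev Poly (k : Type*) [Field k] (n : ℕ) : Type _ := MvPolynomial (Fin (n + 1)) (RatFunc k)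

/-- `L(x₀, …, xₙ)`, where `L = k(t)`. -/
abbrev Frac (k : Type*) [Field k] (n : ℕ) : Type _ := FractionRing (Poly k n)

/-- `d/dt` on `L = k(t)`. -/
def ratDeriv (k : Type*) [Field k] : Derivation k (RatFunc k) (RatFunc k) :=
  extendDerivation (RatFunc k) (Polynomial.derivative' (R := k))

/-- `∂/∂t` on `L(x₀, …, xₙ)`. -/
def dt (k : Type*) [Field k] (n : ℕ) : Derivation k (Frac k n) (Frac k n) :=
  extendDerivation (R := Poly k n) (Frac k n) (coeffDerivation (ratDeriv k))

/-- `∂/∂xᵢ` on `L(x₀, …, xₙ)`. -/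
def dx (k : Type*) [Field k] (n : ℕ) (i : Fin (n + 1)) :
    Derivation (RatFunc k) (Frac k n) (Frac k n) :=
  extendDerivation (R := Poly k n) (Frac k n) (pderiv i)

section

variable {k : Type*} [Field k] {n : ℕ}

/-- The rational function `a / f ^ l`. -/
def overPow (f a : Poly k n) (l : ℕ) : Frac k n :=
  algebraMap (Poly k n) (Frac k n) a / algebraMap (Poly k n) (Frac k n) f ^ l

/-- The ideal generated by `∂f/∂x₀, …, ∂f/∂xₙ`. -/
def jacobianIdeal (f : Poly k n) : Ideal (Poly k n) :=
  Ideal.span (Set.range fun i : Fin (n + 1) => pderiv i f)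

/-- `p` is homogeneous of degree `z`; for `z < 0` this means `p = 0`. -/
def IsHomogeneousInt (p : Poly k n) (z : ℤ) : Prop :=
  p = 0 ∨ ∃ e : ℕ, (e : ℤ) = z ∧ p.IsHomogeneous e

/-- `L[x, 1/f]_z`: the homogeneous rational functions of degree `z` whose denominator is a power
of `f`, where `f` is homogeneous of degree `d`. -/
def homogeneousFractions (f : Poly k n) (d : ℕ) (z : ℤ) : Set (Frac k n) :=
  {F | ∃ (l : ℕ) (a : Poly k n), IsHomogeneousInt a (z + l * d) ∧ F = overPow f a l}

/-- `D_f`: the sums `∑ᵢ ∂Aᵢ/∂xᵢ` with all `Aᵢ` in `L[x, 1/f]_{-n}`. -/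
def exactFractions (f : Poly k n) (d : ℕ) : Set (Frac k n) :=
  {F | ∃ A : Fin (n + 1) → Frac k n,
    (∀ i, A i ∈ homogeneousFractions f d (-(n : ℤ))) ∧ F = ∑ i, dx k n i (A i)}

/-! ### Differential operators and telescopers -/

/-- The elements `∑ⱼ cⱼ ∂ₜʲ` of `L⟨∂ₜ⟩`, given by their coefficients `cⱼ`. -/
abbrev DiffOp (k : Type*) [Field k] : Type _ := ℕ →₀ RatFunc k

/-- `T(F) = ∑ⱼ cⱼ ∂ₜʲ F`. -/
def DiffOp.apply (T : DiffOp k) (F : Frac k n) : Frac k n :=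
  T.sum fun j c => c • (dt k n)^[j] F

/-- The order of a nonzero operator. -/
def DiffOp.order (T : DiffOp k) : ℕ := T.support.sup id

/-- `T` is a (nonzero) telescoper of `F` with regular certificate: `T(F) = ∑ᵢ ∂Aᵢ/∂xᵢ` for rational
functions `Aᵢ` such that every irreducible factor over `k(t)` of the reduced denominator of an `Aᵢ`
divides the reduced denominator of `F`. -/
def IsRegularTelescoper (F : Frac k n) (T : DiffOp k) : Prop :=
  T ≠ 0 ∧ ∃ A : Fin (n + 1) → Frac k n,
    T.apply F = ∑ i, dx k n i (A i) ∧
    ∀ (i : Fin (n + 1)) (p : Poly k n), Irreducible p →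
      p ∣ (IsFractionRing.den (Poly k n) (A i) : Poly k n) →
      p ∣ (IsFractionRing.den (Poly k n) F : Poly k n)

/-- `T` is an operator of least order among those with property `P`. -/
def IsOfMinimalOrder (P : DiffOp k → Prop) (T : DiffOp k) : Prop :=
  P T ∧ ∀ T' : DiffOp k, P T' → T.order ≤ T'.order

/-! ### The Griffiths–Dwork reduction and the algorithm -/

/-- `B` is a Gröbner basis of the ideal `I` for the monomial order `m`: it lies in `I`, and the
leading monomial of every nonzero element of `I` is divisible by that of a nonzero element
of `B`. -/
def IsGroebnerBasis (m : MonomialOrder (Fin (n + 1))) (B : Finset (Poly k n))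
    (I : Ideal (Poly k n)) : Prop :=
  (∀ g ∈ B, g ∈ I) ∧
    ∀ p ∈ I, p ≠ 0 → ∃ g ∈ B, g ≠ 0 ∧ m.degree g ≤ m.degree p

/-- `r` is reduced with respect to `B`: no monomial of `r` is divisible by the leading monomial of
a nonzero element of `B`. -/
def IsReduced (m : MonomialOrder (Fin (n + 1))) (B : Finset (Poly k n)) (r : Poly k n) : Prop :=
  ∀ s ∈ r.support, ∀ g ∈ B, g ≠ 0 → ¬ m.degree g ≤ s

/-- A decomposition `a = r + ∑ᵢ vᵢ ∂f/∂xᵢ` of a homogeneous polynomial `a` of degree `z`, where `r`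
is the normal form with respect to the Gröbner basis `B` and all terms are homogeneous of the same
degree; `f` is homogeneous of degree `d`. -/
def IsDecomposition (m : MonomialOrder (Fin (n + 1))) (B : Finset (Poly k n)) (f : Poly k n)
    (d : ℕ) (z : ℤ) (a r : Poly k n) (v : Fin (n + 1) → Poly k n) : Prop :=
  a = r + ∑ i, v i * pderiv i f ∧ IsReduced m B r ∧ IsHomogeneousInt r z ∧
    ∀ i, IsHomogeneousInt (v i) (z - ((d : ℤ) - 1))

/-- `a / f ^ l`, with `1 ≤ l`, is a way of writing the element `F` of `L[x, 1/f]_{-n-1}`. -/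
def IsWrittenAs (f : Poly k n) (d : ℕ) (F : Frac k n) (l : ℕ) (a : Poly k n) : Prop :=
  1 ≤ l ∧ IsHomogeneousInt a ((l : ℤ) * d - (n + 1)) ∧ F = overPow f a l

/-- The states of the algorithm. -/
inductive State (k : Type*) [Field k] (n : ℕ) : Type _
  /-- Before the first instruction. -/
  | start : State k n
  /-- Inside a call of the reduction procedure that computes the next element of the list
  `G 0, …, G (i - 1)`: it remains to reduce `a / f ^ l` and to add `acc` to the result. -/
  | reduce (i : ℕ) (G : Fin i → Frac k n) (acc : Frac k n) (l : ℕ) (a : Poly k n) : State k n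
  /-- At the head of the loop, with `G 0, …, G i` computed. -/
  | loop (i : ℕ) (G : Fin (i + 1) → Frac k n) : State k n
  /-- The operator `T` has been returned. -/
  | done (T : DiffOp k) : State k n

/-- One step of the algorithm on input `F`. The reduction of `a / f ^ l` returns `a / f` if
`l = 1`; otherwise it decomposes `a = r + ∑ᵢ vᵢ ∂f/∂xᵢ` and returns `r / f ^ l` plus the reduction
of `(1 / (l - 1)) ∑ᵢ (∂vᵢ/∂xᵢ) / f ^ (l - 1)`. The free choices (how a rational function is written
as a fraction, the cofactors `vᵢ`) are left open. -/
inductive Step (m : MonomialOrder (Fin (n + 1))) (B : Finset (Poly k n)) (f : Poly k n) (d : ℕ)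
    (F : Frac k n) : State k n → State k n → Prop
  | init (l : ℕ) (a : Poly k n) (h : IsWrittenAs f d F l a) :
      Step m B f d F .start (.reduce 0 Fin.elim0 0 l a)
  | reduceOne (i : ℕ) (G : Fin i → Frac k n) (acc : Frac k n) (a : Poly k n) :
      Step m B f d F (.reduce i G acc 1 a)
        (.loop i (Fin.snoc (α := fun _ => Frac k n) G (acc + overPow f a 1)))
  | reducePole (i : ℕ) (G : Fin i → Frac k n) (acc : Frac k n) (l : ℕ) (hl : 1 ≤ l)
      (a r : Poly k n) (v : Fin (n + 1) → Poly k n)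
      (h : IsDecomposition m B f d (((l + 1 : ℕ) : ℤ) * d - (n + 1)) a r v) :
      Step m B f d F (.reduce i G acc (l + 1) a)
        (.reduce i G (acc + overPow f r (l + 1)) l (C ((l : RatFunc k)⁻¹) * ∑ j, pderiv j (v j)))
  | finish (i : ℕ) (G : Fin (i + 1) → Frac k n)
      (hrank : Set.finrank (RatFunc k) (Set.range G) < i + 1)
      (c : Fin i → RatFunc k) (hc : ∑ j : Fin i, c j • G j.castSucc = G (Fin.last i)) :
      Step m B f d F (.loop i G)
        (.done (Finsupp.single i 1 - ∑ j : Fin i, Finsupp.single (j : ℕ) (c j)))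
  | continue (i : ℕ) (G : Fin (i + 1) → Frac k n)
      (hrank : ¬ Set.finrank (RatFunc k) (Set.range G) < i + 1)
      (l : ℕ) (a : Poly k n) (h : IsWrittenAs f d (dt k n (G (Fin.last i))) l a) :
      Step m B f d F (.loop i G) (.reduce (i + 1) G 0 l a)

/-- The algorithm reaches the state `s` on input `F`. -/
def Reaches (m : MonomialOrder (Fin (n + 1))) (B : Finset (Poly k n)) (f : Poly k n) (d : ℕ)
    (F : Frac k n) (s : State k n) : Prop :=
  Relation.ReflTransGen (Step m B f d F) .start s

/-- The algorithm terminates on input `F`: no execution is infinite, and an execution that cannot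
be continued has returned an operator. -/
def Terminates (m : MonomialOrder (Fin (n + 1))) (B : Finset (Poly k n)) (f : Poly k n) (d : ℕ)
    (F : Frac k n) : Prop :=
  (¬ ∃ s : ℕ → State k n, s 0 = .start ∧ ∀ j, Step m B f d F (s j) (s (j + 1))) ∧
    ∀ s : State k n, Reaches m B f d F s → (∀ s', ¬ Step m B f d F s s') →
      ∃ T : DiffOp k, s = .done T

end

end Telescoping

end

/-! Let `N` be the span of the summands `r / f ^ l` that the reduction can produce (`normalForms`,
for a large pole order). Each reduction changes its argument only by an element of `D_f`, and `∂ₜ`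
maps `D_f` to itself because it commutes with every `∂ᵢ`; so `G j` represents `∂ₜʲF` modulo `D_f`
and lies in `N`. If `N` meets `D_f` only in zero, then `S(F) ∈ D_f` for `S = ∑ⱼ cⱼ∂ₜʲ` is equivalent
to `∑ⱼ cⱼ G j = 0` (`DiffOp.apply_mem_iff`). The first linear relation among the `G j` is therefore
the minimal operator, and it must occur because `N` is finite-dimensional.

Finite dimension: the Jacobian ideal is homogeneous of finite codimension, so it contains a power of
every variable and every form of large degree. Reduced numerators over a high power of `f` are thus
zero (`exists_normalTerms_le`).

`N ∩ D_f = 0` is Griffiths' theorem (`eq_zero_of_mem_normalForms`). It rests on lowering the pole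
order of certificates (`IsExactAt.of_overPow`): if `∑ᵢ ∂ᵢ(bᵢ / f ^ s)` has pole order at most `s`,
then `f` divides `∑ᵢ bᵢ ∂ᵢf`. Up to a multiple of the Euler field `(Xᵢ)`, the `bᵢ` form a syzygy of
the partial derivatives. Such a syzygy is a combination of the trivial ones, by exactness of the
Koszul complex (`koszul_exact_mod`), and trivial syzygies yield a certificate over `f ^ (s - 1)`.
Afterwards the top numerator of a normal form in `D_f` lies in the Jacobian ideal, so it vanishes.

It remains to compare `D_f` with regular certificates (`isRegularTelescoper_iff`). The difficulty is
that the reduced denominator of `F` may miss some factors of `f`. For `n ≥ 2` this is harmless,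
since `f` is not a product of two nonconstant forms; for `n = 1` the superfluous factors are removed
by partial fractions; for `n = 0` the space `D_f` is zero. -/

noncomputable section

namespace Telescoping

/-! ### Syzygies of a system of parameters -/

section Koszul

variable {L : Type*} [Field L] {m : ℕ}

/-- The `i`-th term of the Koszul complex of `m` polynomials in `m` variables. -/
abbrev KoszulTerm (L : Type*) [Field L] (m i : ℕ) : Type _ :=
  (Fin m → L) [⋀^Fin i]→ₗ[L] MvPolynomial (Fin m) L

instance (i : ℕ) : IsScalarTower L (MvPolynomial (Fin m) L) (KoszulTerm L m i) :=
  ⟨fun a p z => by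
    ext v : 1
    simp⟩

theorem koszulTerm_sum_apply {ι : Type*} (s : Finset ι) {i : ℕ} (z : ι → KoszulTerm L m i)
    (v : Fin i → Fin m → L) : (∑ a ∈ s, z a) v = ∑ a ∈ s, z a v := by
  classical
  induction s using Finset.induction_on with
  | empty => simp
  | insert a s ha ih => rw [Finset.sum_insert ha, Finset.sum_insert ha, ← ih]; rfl

/-- The differential of the Koszul complex: contraction with `f`. -/
def koszulD (f : Fin m → MvPolynomial (Fin m) L) {i : ℕ} (z : KoszulTerm L m (i + 1)) :
    KoszulTerm L m i :=
  ∑ a, f a • z.curryLeft (Pi.single a 1)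

/-- Exterior multiplication with the linear form with coefficients `g`. -/
def koszulH (g : Fin m → MvPolynomial (Fin m) L) {i : ℕ} (z : KoszulTerm L m i) :
    KoszulTerm L m (i + 1) :=
  AlternatingMap.alternatizeUncurryFin ((Fintype.linearCombination L g).smulRight z)

theorem koszulD_apply (f : Fin m → MvPolynomial (Fin m) L) {i : ℕ} (z : KoszulTerm L m (i + 1))
    (v : Fin i → Fin m → L) :
    koszulD f z v = ∑ a, f a * z (Matrix.vecCons (Pi.single a 1) v) := by
  simp [koszulD, koszulTerm_sum_apply]

theorem koszulH_apply (g : Fin m → MvPolynomial (Fin m) L) {i : ℕ} (z : KoszulTerm L m i)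
    (v : Fin (i + 1) → Fin m → L) :
    koszulH g z v = ∑ j : Fin (i + 1), (-1) ^ (j : ℕ) *
      (Fintype.linearCombination L g (v j) * z (j.removeNth v)) := by
  simp only [koszulH, AlternatingMap.alternatizeUncurryFin_apply]
  refine Finset.sum_congr rfl fun j _ => ?_
  rcases neg_one_pow_eq_or ℤ (j : ℕ) with h | h <;>
  rcases Nat.even_or_odd (j : ℕ) with h' | h' <;> simp [h'.neg_one_pow]

theorem koszulD_sub (f : Fin m → MvPolynomial (Fin m) L) {i : ℕ} (z w : KoszulTerm L m (i + 1)) :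
    koszulD f (z - w) = koszulD f z - koszulD f w := by
  ext v : 1
  simp [koszulD_apply, mul_sub]

theorem koszulD_smul (f : Fin m → MvPolynomial (Fin m) L) {i : ℕ} (z : KoszulTerm L m (i + 1))
    (p : MvPolynomial (Fin m) L) : koszulD f (p • z) = p • koszulD f z := by
  ext v : 1
  simp only [koszulD_apply, AlternatingMap.smul_apply, smul_eq_mul, Finset.mul_sum]
  exact Finset.sum_congr rfl fun _ _ => by ring

theorem koszulD_koszulD (f : Fin m → MvPolynomial (Fin m) L) {i : ℕ}
    (z : KoszulTerm L m (i + 2)) : koszulD f (koszulD f z) = 0 := by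
  ext v : 1
  simp only [koszulD_apply, Finset.mul_sum, AlternatingMap.zero_apply]
  rw [← Finset.sum_product']
  -- Exchanging the two inserted basis vectors pairs each term with its negative; terms on the
  -- diagonal vanish.
  refine Finset.sum_involution (fun p _ => (p.2, p.1)) ?_ ?_ ?_ ?_
  · rintro ⟨a, b⟩ -
    have h := z.map_swap
      (Matrix.vecCons (Pi.single b (1 : L)) (Matrix.vecCons (Pi.single a 1) v))
      (i := 0) (j := 1) (by simp)
    have e : (Matrix.vecCons (Pi.single b (1 : L)) (Matrix.vecCons (Pi.single a 1) v) ∘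
        Equiv.swap (0 : Fin (i + 2)) 1) =
        Matrix.vecCons (Pi.single a (1 : L)) (Matrix.vecCons (Pi.single b 1) v) := by
      funext j
      refine Fin.cases ?_ (fun j => ?_) j
      · simp
      · refine Fin.cases ?_ (fun j => ?_) j
        · simp
        · rw [Function.comp_apply, Equiv.swap_apply_of_ne_of_ne]
          · simp
          · exact Fin.succ_ne_zero _
          · simp [Fin.ext_iff]
    rw [e] at h
    simp only [h]
    ring
  · rintro ⟨a, b⟩ - hne h
    apply hne
    simp only [Prod.mk.injEq] at h
    obtain ⟨rfl, -⟩ := h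
    rw [z.map_eq_zero_of_eq _ (i := 0) (j := 1) (by simp) (by simp)]
    simp
  · simp
  · simp

/-- Exterior multiplication is a contracting homotopy up to the factor `∑ₐ gₐ fₐ`, so every element
of the ideal generated by `f` acts as zero on Koszul homology. The term that removes the inserted
vector gives the scalar; the others give the homotopy with the opposite sign. -/
theorem koszulD_koszulH (f g : Fin m → MvPolynomial (Fin m) L) {i : ℕ}
    (z : KoszulTerm L m (i + 1)) :
    koszulD f (koszulH g z) = (∑ a, g a * f a) • z - koszulH g (koszulD f z) := by
  ext v : 1
  have e (a : Fin m) : Fintype.linearCombination L g (Pi.single a 1) = g a := by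
    simp [Fintype.linearCombination_apply_single]
  simp only [koszulD_apply, koszulH_apply, AlternatingMap.sub_apply, AlternatingMap.smul_apply,
    smul_eq_mul]
  simp only [Fin.sum_univ_succ (n := i + 1), Matrix.cons_val_zero, Matrix.cons_val_succ, e,
    mul_add, Finset.sum_add_distrib, Finset.sum_mul, Finset.mul_sum, sub_eq_add_neg,
    ← Finset.sum_neg_distrib]
  congr 1
  · refine Finset.sum_congr rfl fun a _ => ?_
    have : (0 : Fin (i + 2)).removeNth (Matrix.vecCons (Pi.single a (1 : L)) v) = v := by
      funext j
      simp [Fin.removeNth]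
    simp [this]
    ring
  · rw [Finset.sum_comm]
    refine Finset.sum_congr rfl fun j _ => Finset.sum_congr rfl fun a _ => ?_
    have : j.succ.removeNth (Matrix.vecCons (Pi.single a (1 : L)) v) =
        Matrix.vecCons (Pi.single a 1) (j.removeNth v) := by
      funext l
      refine Fin.cases ?_ (fun l => ?_) l
      · simp [Fin.removeNth]
      · simp [Fin.removeNth]
    rw [this]
    simp [pow_succ]
    ring

/-- The ideal generated by the `N`-th powers of the first `j` variables. -/
def powerIdeal (L : Type*) [Field L] (m N j : ℕ) : Ideal (MvPolynomial (Fin m) L) :=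
  Ideal.span ((fun s => monomial s 1) '' ((fun i : Fin m => Finsupp.single i N) '' {i | i.1 < j}))

theorem mem_powerIdeal {N j : ℕ} {p : MvPolynomial (Fin m) L} :
    p ∈ powerIdeal L m N j ↔ ∀ s, coeff s p ≠ 0 → ∃ i : Fin m, i.1 < j ∧ N ≤ s i := by
  simp [powerIdeal, mem_ideal_span_monomial_image]

/-- `X j ^ N` is a nonzerodivisor modulo the powers of the earlier variables: the ideal is monomial,
and a shift by `X j ^ N` leaves the exponents of those variables unchanged. -/
theorem mem_powerIdeal_of_mul {N : ℕ} {j : Fin m} {p : MvPolynomial (Fin m) L}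
    (h : X j ^ N * p ∈ powerIdeal L m N j) : p ∈ powerIdeal L m N j := by
  rw [mem_powerIdeal] at h ⊢
  intro s hs
  obtain ⟨i, hi, hN⟩ := h (Finsupp.single j N + s) (by
    rw [X_pow_eq_monomial, coeff_monomial_mul, one_mul]
    exact hs)
  refine ⟨i, hi, ?_⟩
  have hne : j ≠ i := fun e => by simp [e] at hi
  simpa [Finsupp.single_apply, hne] using hN

/-- The quotient by `X j ^ N` is taken with `divMonomial` because this is linear in `p`; it can then
be applied to the values of an alternating map. -/
theorem sub_mul_mem_powerIdeal {N : ℕ} {j : Fin m} {p : MvPolynomial (Fin m) L}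
    (h : p ∈ powerIdeal L m N (j.1 + 1)) :
    p - X j ^ N * p.divMonomial (Finsupp.single j N) ∈ powerIdeal L m N j := by
  have e : p - X j ^ N * p.divMonomial (Finsupp.single j N) =
      p.modMonomial (Finsupp.single j N) := by
    rw [sub_eq_iff_eq_add, X_pow_eq_monomial, add_comm, divMonomial_add_modMonomial]
  rw [e]
  rw [mem_powerIdeal] at h ⊢
  intro s hs
  have hle : ¬ Finsupp.single j N ≤ s := fun hle => hs (coeff_modMonomial_of_le _ hle)
  rw [coeff_modMonomial_of_not_le _ hle] at hs
  obtain ⟨i, hi, hN⟩ := h s hs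
  refine ⟨i, ?_, hN⟩
  rcases Nat.lt_succ_iff_lt_or_eq.1 hi with h1 | h1
  · exact h1
  · exact absurd (by rw [Finsupp.single_le_iff]; rwa [Fin.ext h1] at hN) hle

theorem koszulTerm_eq_zero {i : ℕ} (hi : m < i) (z : KoszulTerm L m i) : z = 0 := by
  ext v : 1
  refine z.map_linearDependent v fun h => ?_
  have := h.fintype_card_le_finrank
  simp at this
  omega

/-- Exactness in degrees above `j`, modulo the `N`-th powers of the first `j` variables, by
descending induction on `j = m - t`. For `j = m` the terms involved are zero. In the step write `x =
X j ^ N = ∑ₐ gₐ fₐ`, and let `H` be multiplication with `g`. If `d z ≡ 0`, then `d (H z) ≡ x z`, so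
`H z` is a cycle modulo `x` as well and the induction gives `H z ≡ d u + x w`. Applying `d` yields
`x z ≡ x (d w)`, and `x` can be cancelled. -/
theorem koszul_exact_mod {N : ℕ} (f : Fin m → MvPolynomial (Fin m) L)
    (hx : ∀ j, X j ^ N ∈ Ideal.span (Set.range f)) (t : ℕ) :
    ∀ j i : ℕ, j + t = m → j ≤ i → ∀ z : KoszulTerm L m (i + 1),
      (∀ v, koszulD f z v ∈ powerIdeal L m N j) →
      ∃ u : KoszulTerm L m (i + 2), ∀ v, (z - koszulD f u) v ∈ powerIdeal L m N j := by
  induction t with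
  | zero =>
    intro j i hj hi z _
    refine ⟨0, fun v => ?_⟩
    rw [koszulTerm_eq_zero (by omega) (z - koszulD f 0)]
    simp
  | succ t ih =>
    intro j i hj hi z hz
    let J : Fin m := ⟨j, by omega⟩
    obtain ⟨g, hg⟩ := (Ideal.mem_span_range_iff_exists_fun).1 (hx J)
    have h1 (v : Fin (i + 1) → Fin m → L) :
        (koszulD f (koszulH g z) - (X J ^ N : MvPolynomial (Fin m) L) • z) v ∈
          powerIdeal L m N j := by
      rw [koszulD_koszulH, hg, sub_sub_cancel_left, AlternatingMap.neg_apply, koszulH_apply]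
      refine neg_mem (sum_mem fun l _ => ?_)
      exact Ideal.mul_mem_left _ _ (Ideal.mul_mem_left _ _ (hz _))
    have hle : powerIdeal L m N j ≤ powerIdeal L m N (j + 1) := fun p hp => by
      rw [mem_powerIdeal] at hp ⊢
      intro s hs
      obtain ⟨i, hi, h⟩ := hp s hs
      exact ⟨i, by omega, h⟩
    have hX : X J ^ N ∈ powerIdeal L m N (j + 1) := by
      rw [X_pow_eq_monomial]
      exact Ideal.subset_span ⟨_, ⟨J, by simp [J], rfl⟩, rfl⟩
    obtain ⟨u, hu⟩ := ih (j + 1) (i + 1) (by omega) (by omega) (koszulH g z) fun v => by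
      have := add_mem (hle (h1 v)) (Ideal.mul_mem_right (z v) (powerIdeal L m N (j + 1)) hX)
      simpa using this
    -- The quotient by `X J ^ N` of `koszulH g z - koszulD f u`, which lies in the ideal with the
    -- `N`-th power of `X J` adjoined.
    let w : KoszulTerm L m (i + 2) :=
      ({ toFun := fun p => p.divMonomial (Finsupp.single J N)
         map_add' := fun p q => add_divMonomial _ _ _
         map_smul' := fun c p => by
          ext s
          simp [coeff_divMonomial] } :
        MvPolynomial (Fin m) L →ₗ[L] MvPolynomial (Fin m) L).compAlternatingMap
        (koszulH g z - koszulD f u)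
    refine ⟨w, fun v => mem_powerIdeal_of_mul (j := J) ?_⟩
    have h2 (v : Fin (i + 2) → Fin m → L) :
        (koszulH g z - koszulD f u - (X J ^ N : MvPolynomial (Fin m) L) • w) v ∈
          powerIdeal L m N j := by
      simpa [w] using sub_mul_mem_powerIdeal (j := J) (hu v)
    have h3 : koszulD f (koszulH g z - koszulD f u - (X J ^ N : MvPolynomial (Fin m) L) • w) v ∈
        powerIdeal L m N j := by
      rw [koszulD_apply]
      exact sum_mem fun a _ => Ideal.mul_mem_left _ _ (h2 _)
    rw [koszulD_sub, koszulD_sub, koszulD_koszulD, sub_zero, koszulD_smul] at h3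
    have := sub_mem h3 (h1 v)
    simp only [AlternatingMap.sub_apply, AlternatingMap.smul_apply, smul_eq_mul] at this ⊢
    convert this using 1
    ring

/-- If the ideal generated by `m` polynomials in `m` variables contains a power of every variable,
then the syzygies of these polynomials are generated by the trivial ones. -/
theorem exists_alternating_of_syzygy {N : ℕ} (f : Fin m → MvPolynomial (Fin m) L)
    (hx : ∀ j, X j ^ N ∈ Ideal.span (Set.range f)) (b : Fin m → MvPolynomial (Fin m) L)
    (hb : ∑ i, b i * f i = 0) :
    ∃ h : Fin m → Fin m → MvPolynomial (Fin m) L,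
      (∀ i, h i i = 0) ∧ (∀ i j, h i j = -h j i) ∧ ∀ i, b i = ∑ j, h i j * f j := by
  let z : KoszulTerm L m 1 := AlternatingMap.ofSubsingleton L (Fin m → L) _ (0 : Fin 1)
    (Fintype.linearCombination L b)
  have hz (a : Fin m) (v) : z (Matrix.vecCons (Pi.single a 1) v) = b a := by
    simp [z, Fintype.linearCombination_apply_single]
  -- With `j = 0` the ideal of powers is zero, so this is exactness in degree one of the Koszul
  -- complex itself.
  obtain ⟨u, hu⟩ := koszul_exact_mod f hx m 0 0 (by simp) le_rfl z fun v => by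
    rw [koszulD_apply]
    simp only [hz]
    rw [show ∑ a, f a * b a = 0 by rw [← hb]; exact Finset.sum_congr rfl fun _ _ => mul_comm _ _]
    exact zero_mem _
  refine ⟨fun i j => u ![Pi.single j 1, Pi.single i 1], fun i => ?_, fun i j => ?_, fun i => ?_⟩
  · exact u.map_eq_zero_of_eq _ (i := 0) (j := 1) (by simp) (by simp)
  · have h := u.map_swap ![Pi.single i (1 : L), Pi.single j 1] (i := 0) (j := 1) (by simp)
    have e : (![Pi.single i 1, Pi.single j 1] : Fin 2 → Fin m → L) ∘ Equiv.swap (0 : Fin 2) 1 =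
        ![Pi.single j 1, Pi.single i 1] := by
      funext l
      fin_cases l <;> simp
    rw [e] at h
    exact h
  · have h := hu ![Pi.single i 1]
    have h0 : powerIdeal L m N 0 = ⊥ := by simp [powerIdeal]
    rw [h0, Ideal.mem_bot, AlternatingMap.sub_apply, hz, sub_eq_zero, koszulD_apply] at h
    rw [h]
    exact Finset.sum_congr rfl fun _ _ => mul_comm _ _

end Koszul

/-! ### Homogeneous polynomials with integral degrees -/

section Homogeneous

variable {k : Type*} [Field k] {n : ℕ}

theorem isHomogeneousInt_iff {p : Poly k n} {z : ℤ} :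
    IsHomogeneousInt p z ↔ ∀ s, coeff s p ≠ 0 → (s.degree : ℤ) = z := by
  constructor
  · rintro (rfl | ⟨e, rfl, he⟩) s hs
    · simp at hs
    · by_contra h
      exact hs (he.coeff_eq_zero fun h' => h (by rw [h']))
  · intro h
    by_cases hz : 0 ≤ z
    · obtain ⟨e, rfl⟩ := Int.eq_ofNat_of_zero_le hz
      refine Or.inr ⟨e, rfl, fun s hs => ?_⟩
      have := h s hs
      have h1 : (Finsupp.weight 1) s = s.degree := by
        rw [Finsupp.degree_eq_weight_one]
        rfl
      rw [h1]
      exact_mod_cast this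
    · left
      ext s
      by_contra hs
      have := h s hs
      omega

theorem isHomogeneousInt_natCast {p : Poly k n} {e : ℕ} :
    IsHomogeneousInt p e ↔ p.IsHomogeneous e := by
  refine ⟨?_, fun h => Or.inr ⟨e, rfl, h⟩⟩
  rintro (rfl | ⟨e', he, h⟩)
  · exact isHomogeneous_zero _ _ _
  · obtain rfl : e' = e := by exact_mod_cast he
    exact h

theorem IsHomogeneousInt.eq_zero {p : Poly k n} {z : ℤ} (h : IsHomogeneousInt p z) (hz : z < 0) :
    p = 0 := by
  rcases h with h | ⟨e, he, -⟩
  · exact h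
  · omega

variable (k n) in
/-- The space of homogeneous polynomials of degree `z`. -/
def homogeneousInt (z : ℤ) : Submodule (RatFunc k) (Poly k n) where
  carrier := {p | IsHomogeneousInt p z}
  add_mem' := by
    intro p q hp hq
    rw [Set.mem_ofPred_eq, isHomogeneousInt_iff] at *
    intro s hs
    by_cases h : coeff s p = 0
    · exact hq s fun h' => hs (by simp [h, h'])
    · exact hp s h
  zero_mem' := Or.inl rfl
  smul_mem' := by
    intro c p hp
    rw [Set.mem_ofPred_eq, isHomogeneousInt_iff] at *
    intro s hs
    exact hp s fun h' => hs (by simp [h'])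

instance (z : ℤ) : Module.Finite (RatFunc k) (homogeneousInt k n z) := by
  by_cases hz : 0 ≤ z
  · obtain ⟨e, rfl⟩ := Int.eq_ofNat_of_zero_le hz
    have : homogeneousInt k n (e : ℤ) = homogeneousSubmodule (Fin (n + 1)) (RatFunc k) e := by
      ext p
      exact isHomogeneousInt_natCast
    rw [this]
    exact Module.Finite.iff_fg.2 (homogeneousSubmodule_fg _ _ e)
  · have : homogeneousInt k n z = ⊥ := by
      rw [eq_bot_iff]
      intro p hp
      exact IsHomogeneousInt.eq_zero hp (by omega)
    rw [this]
    infer_instance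

namespace IsHomogeneousInt

variable {p q : Poly k n} {y z : ℤ}

protected theorem zero : IsHomogeneousInt (0 : Poly k n) z := Or.inl rfl

protected theorem add (hp : IsHomogeneousInt p z) (hq : IsHomogeneousInt q z) :
    IsHomogeneousInt (p + q) z :=
  (homogeneousInt k n z).add_mem hp hq

protected theorem sub (hp : IsHomogeneousInt p z) (hq : IsHomogeneousInt q z) :
    IsHomogeneousInt (p - q) z :=
  (homogeneousInt k n z).sub_mem hp hq

protected theorem sum {ι : Type*} {s : Finset ι} {p : ι → Poly k n}
    (h : ∀ i ∈ s, IsHomogeneousInt (p i) z) : IsHomogeneousInt (∑ i ∈ s, p i) z :=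
  (homogeneousInt k n z).sum_mem h

protected theorem smul (c : RatFunc k) (hp : IsHomogeneousInt p z) : IsHomogeneousInt (c • p) z :=
  (homogeneousInt k n z).smul_mem c hp

protected theorem C_mul (c : RatFunc k) (hp : IsHomogeneousInt p z) :
    IsHomogeneousInt (C c * p) z := by
  rw [← smul_eq_C_mul]
  exact hp.smul c

protected theorem mul (hp : IsHomogeneousInt p y) (hq : IsHomogeneousInt q z) :
    IsHomogeneousInt (p * q) (y + z) := by
  classical
  rw [isHomogeneousInt_iff] at *
  intro s hs
  rw [coeff_mul] at hs
  obtain ⟨⟨a, b⟩, hab, hne⟩ := Finset.exists_ne_zero_of_sum_ne_zero hs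
  rw [Finset.HasAntidiagonal.mem_antidiagonal] at hab
  rw [← hab, map_add, Nat.cast_add, hp a (left_ne_zero_of_mul hne),
    hq b (right_ne_zero_of_mul hne)]

protected theorem pow {d : ℕ} (hp : p.IsHomogeneous d) (l : ℕ) :
    IsHomogeneousInt (p ^ l) (l * d) := by
  have := isHomogeneousInt_natCast.2 (hp.pow l)
  push_cast at this
  rwa [mul_comm]

protected theorem pderiv (hp : IsHomogeneousInt p z) (i : Fin (n + 1)) :
    IsHomogeneousInt (pderiv i p) (z - 1) := by
  rw [isHomogeneousInt_iff] at *
  intro s hs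
  rw [coeff_pderiv] at hs
  rw [← hp _ (left_ne_zero_of_mul hs), map_add, Finsupp.degree_single]
  simp

protected theorem coeffDerivation (D : Derivation k (RatFunc k) (RatFunc k))
    (hp : IsHomogeneousInt p z) : IsHomogeneousInt (coeffDerivation D p) z := by
  rw [isHomogeneousInt_iff] at *
  intro s hs
  refine hp s fun h => hs ?_
  change coeff s (coeffMap D p) = 0
  rw [coeff_coeffMap, h, map_zero]

/-- Euler's identity. -/
theorem sum_X_mul_pderiv (hp : IsHomogeneousInt p z) :
    ∑ i, X i * pderiv i p = (z : Poly k n) * p := by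
  rcases hp with rfl | ⟨e, rfl, hp⟩
  · simp
  · rw [hp.sum_X_mul_pderiv]
    simp

end IsHomogeneousInt

variable (k n) in
/-- The projection to the homogeneous polynomials of degree `z`. -/
def intComponent (z : ℤ) : Poly k n →ₗ[RatFunc k] Poly k n :=
  if 0 ≤ z then homogeneousComponent z.toNat else 0

theorem coeff_intComponent (z : ℤ) (p : Poly k n) (s : Fin (n + 1) →₀ ℕ) :
    coeff s (intComponent k n z p) = if (s.degree : ℤ) = z then coeff s p else 0 := by
  unfold intComponent
  split_ifs with h1 h2 h2
  · rw [coeff_homogeneousComponent, if_pos (by omega)]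
  · rw [coeff_homogeneousComponent, if_neg (by omega)]
  · omega
  · simp

theorem isHomogeneousInt_intComponent (z : ℤ) (p : Poly k n) :
    IsHomogeneousInt (intComponent k n z p) z := by
  rw [isHomogeneousInt_iff]
  intro s hs
  by_contra h
  exact hs (by rw [coeff_intComponent, if_neg h])

theorem IsHomogeneousInt.intComponent_eq {p : Poly k n} {z : ℤ} (hp : IsHomogeneousInt p z) :
    intComponent k n z p = p := by
  ext s
  rw [coeff_intComponent]
  split_ifs with h
  · rfl
  · by_contra hs
    exact h (isHomogeneousInt_iff.1 hp s (Ne.symm hs))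

theorem intComponent_mul {g : Poly k n} {y : ℤ} (hg : IsHomogeneousInt g y) (z : ℤ)
    (p : Poly k n) : intComponent k n z (g * p) = g * intComponent k n (z - y) p := by
  classical
  rw [isHomogeneousInt_iff] at hg
  ext s
  rw [coeff_intComponent, coeff_mul, coeff_mul]
  trans ∑ x ∈ Finset.HasAntidiagonal.antidiagonal s,
    if (s.degree : ℤ) = z then coeff x.1 g * coeff x.2 p else 0
  · split_ifs <;> simp
  refine Finset.sum_congr rfl fun x hx => ?_
  rw [coeff_intComponent]
  by_cases h : coeff x.1 g = 0
  · simp [h]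
  · have h3 := hg _ h
    have : (x.2.degree : ℤ) = z - y ↔ (s.degree : ℤ) = z := by
      rw [← Finset.HasAntidiagonal.mem_antidiagonal.1 hx, map_add]
      push_cast
      omega
    rw [if_congr this rfl rfl]
    split_ifs <;> simp

theorem intComponent_pderiv (i : Fin (n + 1)) (z : ℤ) (p : Poly k n) :
    intComponent k n z (pderiv i p) = pderiv i (intComponent k n (z + 1) p) := by
  ext s
  simp only [coeff_intComponent, coeff_pderiv, map_add, Finsupp.degree_single]
  push_cast
  simp only [add_left_inj]
  split_ifs <;> simp

theorem pderiv_pderiv_comm (i j : Fin (n + 1)) (p : Poly k n) :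
    pderiv i (pderiv j p) = pderiv j (pderiv i p) := by
  ext s
  simp only [coeff_pderiv, Finsupp.add_apply]
  rw [add_right_comm]
  by_cases h : i = j
  · subst h; ring
  · simp [h, Ne.symm h]
    ring

theorem coeffDerivation_pderiv (D : Derivation k (RatFunc k) (RatFunc k)) (i : Fin (n + 1))
    (p : Poly k n) : coeffDerivation D (pderiv i p) = pderiv i (coeffDerivation D p) := by
  ext s
  change coeff s (coeffMap D _) = coeff s (pderiv i (coeffMap D p))
  rw [coeff_coeffMap, coeff_pderiv, coeff_pderiv, coeff_coeffMap, Derivation.leibniz]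
  have : D ((s i : RatFunc k) + 1) = 0 := by
    have := D.map_natCast (s i + 1)
    push_cast at this
    exact this
  rw [this, smul_zero, zero_add, smul_eq_mul, mul_comm]

/-- Substituting `Xᵢ ↦ Xᵢ T` turns homogeneous components into coefficients of powers of `T`. The
product becomes a monomial in `T`; as lowest and highest degrees in `T` are both additive, they
agree for each factor. -/
theorem isHomogeneous_of_mul_left {p q : Poly k n} {d : ℕ}
    (h : (p * q).IsHomogeneous d) (h0 : p * q ≠ 0) : ∃ e, p.IsHomogeneous e := by
  let φ : Poly k n →ₐ[RatFunc k] Polynomial (Poly k n) :=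
    aeval fun i => Polynomial.C (X i) * Polynomial.X
  have hφm (s : Fin (n + 1) →₀ ℕ) (c : RatFunc k) :
      φ (monomial s c) = Polynomial.monomial s.degree (monomial s c) := by
    simp only [φ, aeval_monomial, mul_pow, Finsupp.prod, Finset.prod_mul_distrib]
    rw [Finset.prod_pow_eq_pow_sum]
    rw [← Polynomial.C_mul_X_pow_eq_monomial, ← mul_assoc]
    congr 1
    rw [monomial_eq, map_mul, Finsupp.prod, map_prod]
    simp only [map_pow]
    rfl
  have hφ (p : Poly k n) (e : ℕ) : (φ p).coeff e = homogeneousComponent e p := by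
    induction p using MvPolynomial.induction_on' with
    | monomial s c =>
      rw [hφm, Polynomial.coeff_monomial]
      split_ifs with he
      · rw [homogeneousComponent_of_mem (m := e) (n := s.degree)]
        · rw [if_pos he.symm]
        · exact isHomogeneous_monomial _ rfl
      · rw [homogeneousComponent_of_mem (m := e) (n := s.degree)]
        · rw [if_neg (Ne.symm he)]
        · exact isHomogeneous_monomial _ rfl
    | add p q hp hq => rw [map_add, Polynomial.coeff_add, hp, hq, map_add]
  have hφ0 (p : Poly k n) (hp : p ≠ 0) : φ p ≠ 0 := by
    intro hz
    apply hp
    rw [← sum_homogeneousComponent p]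
    exact Finset.sum_eq_zero fun e _ => by rw [← hφ, hz, Polynomial.coeff_zero]
  have hpq : φ p * φ q = Polynomial.monomial d (p * q) := by
    rw [← map_mul]
    ext1 e
    rw [hφ, Polynomial.coeff_monomial, homogeneousComponent_of_mem h]
    simp only [eq_comm]
  have hp := hφ0 p (left_ne_zero_of_mul h0)
  have hq := hφ0 q (right_ne_zero_of_mul h0)
  have h1 := Polynomial.natDegree_mul hp hq
  have h2 := Polynomial.natTrailingDegree_mul hp hq
  rw [hpq, Polynomial.natDegree_monomial_eq _ h0] at h1
  rw [hpq, Polynomial.natTrailingDegree_monomial h0] at h2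
  have h3 := (φ p).natTrailingDegree_le_natDegree
  have h4 := (φ q).natTrailingDegree_le_natDegree
  refine ⟨(φ p).natDegree, ?_⟩
  have : homogeneousComponent (φ p).natDegree p = p := by
    conv_rhs => rw [← sum_homogeneousComponent p]
    by_cases hle : (φ p).natDegree ∈ Finset.range (p.totalDegree + 1)
    · rw [Finset.sum_eq_single_of_mem _ hle]
      intro e _ he
      rw [← hφ]
      rcases lt_or_gt_of_ne he with he | he
      · exact Polynomial.coeff_eq_zero_of_lt_natTrailingDegree (by omega)
      · exact Polynomial.coeff_eq_zero_of_natDegree_lt he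
    · have : (φ p).leadingCoeff = 0 := by
        rw [Polynomial.leadingCoeff, hφ]
        exact homogeneousComponent_eq_zero _ _ (by simpa using hle)
      exact absurd (Polynomial.leadingCoeff_eq_zero.1 this) hp
  have h5 := homogeneousComponent_isHomogeneous (φ p).natDegree p
  rwa [this] at h5

end Homogeneous

/-! ### The Jacobian ideal -/

section Jacobian

variable {k : Type*} [Field k] {n d : ℕ} {f : Poly k n}

theorem mem_jacobianIdeal {p : Poly k n} :
    p ∈ jacobianIdeal f ↔ ∃ v : Fin (n + 1) → Poly k n, ∑ i, v i * pderiv i f = p :=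
  Ideal.mem_span_range_iff_exists_fun

theorem isHomogeneousInt_pderiv (hf : f.IsHomogeneous d) (i : Fin (n + 1)) :
    IsHomogeneousInt (pderiv i f) ((d : ℤ) - 1) :=
  (isHomogeneousInt_natCast.2 hf).pderiv i

theorem intComponent_sum_mul_pderiv (hf : f.IsHomogeneous d) (z : ℤ)
    (v : Fin (n + 1) → Poly k n) :
    intComponent k n z (∑ i, v i * pderiv i f) =
      ∑ i, intComponent k n (z - ((d : ℤ) - 1)) (v i) * pderiv i f := by
  rw [map_sum]
  refine Finset.sum_congr rfl fun i _ => ?_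
  rw [mul_comm, intComponent_mul (isHomogeneousInt_pderiv hf i), mul_comm]

theorem intComponent_mem_jacobianIdeal (hf : f.IsHomogeneous d) {p : Poly k n}
    (hp : p ∈ jacobianIdeal f) (z : ℤ) : intComponent k n z p ∈ jacobianIdeal f := by
  obtain ⟨v, rfl⟩ := mem_jacobianIdeal.1 hp
  rw [intComponent_sum_mul_pderiv hf]
  exact mem_jacobianIdeal.2 ⟨_, rfl⟩

theorem exists_homogeneous_cofactors (hf : f.IsHomogeneous d) {p : Poly k n} {z : ℤ}
    (hp : p ∈ jacobianIdeal f) (hz : IsHomogeneousInt p z) :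
    ∃ v : Fin (n + 1) → Poly k n, (∀ i, IsHomogeneousInt (v i) (z - ((d : ℤ) - 1))) ∧
      p = ∑ i, v i * pderiv i f := by
  obtain ⟨v, rfl⟩ := mem_jacobianIdeal.1 hp
  refine ⟨fun i => intComponent k n (z - ((d : ℤ) - 1)) (v i),
    fun i => isHomogeneousInt_intComponent _ _, ?_⟩
  rw [← intComponent_sum_mul_pderiv hf, hz.intComponent_eq]

/-- In the finite-dimensional quotient the class of `X j` is a root of a monic polynomial `P`. The
ideal is homogeneous, so it contains the top component of `P (X j)`, which is a power of `X j`. -/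
theorem exists_X_pow_mem_jacobianIdeal (hf : f.IsHomogeneous d)
    (hreg : Module.Finite (RatFunc k) (Poly k n ⧸ jacobianIdeal f)) :
    ∃ N : ℕ, ∀ j, X j ^ N ∈ jacobianIdeal f := by
  have h (j : Fin (n + 1)) : ∃ N : ℕ, X j ^ N ∈ jacobianIdeal f := by
    obtain ⟨P, hP, h0⟩ := IsIntegral.of_finite (RatFunc k)
      (Ideal.Quotient.mkₐ (RatFunc k) (jacobianIdeal f) (X j))
    refine ⟨P.natDegree, ?_⟩
    rw [← Polynomial.aeval_def, Polynomial.aeval_algHom_apply] at h0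
    have hmem : Polynomial.aeval (X j : Poly k n) P ∈ jacobianIdeal f :=
      Ideal.Quotient.eq_zero_iff_mem.1 h0
    have := intComponent_mem_jacobianIdeal hf hmem P.natDegree
    rw [Polynomial.aeval_eq_sum_range, map_sum, Finset.sum_range_succ, Finset.sum_eq_zero,
      zero_add, map_smul, hP.coeff_natDegree, one_smul, IsHomogeneousInt.intComponent_eq] at this
    · exact this
    · exact isHomogeneousInt_natCast.2 (isHomogeneous_X_pow j _)
    · intro e he
      rw [map_smul]
      ext s
      rw [coeff_smul, coeff_intComponent]
      split_ifs with hs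
      · rw [(isHomogeneous_X_pow j e).coeff_eq_zero]
        · simp
        · have := Finset.mem_range.1 he
          omega
      · simp
  choose N hN using h
  refine ⟨∑ j, N j, fun j => ?_⟩
  rw [← Finset.sum_erase_add _ _ (Finset.mem_univ j), pow_add]
  exact Ideal.mul_mem_left _ _ (hN j)

theorem ne_zero_of_finite (hf : f.IsHomogeneous d)
    (hreg : Module.Finite (RatFunc k) (Poly k n ⧸ jacobianIdeal f)) : f ≠ 0 := by
  rintro rfl
  obtain ⟨N, hN⟩ := exists_X_pow_mem_jacobianIdeal hf hreg
  obtain ⟨v, hv⟩ := mem_jacobianIdeal.1 (hN 0)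
  simp only [map_zero, mul_zero, Finset.sum_const_zero] at hv
  exact pow_ne_zero N (X_ne_zero 0) hv.symm

theorem degree_pos_of_finite (hf : f.IsHomogeneous d)
    (hreg : Module.Finite (RatFunc k) (Poly k n ⧸ jacobianIdeal f)) : 0 < d := by
  rcases Nat.eq_zero_or_pos d with rfl | h
  · obtain ⟨N, hN⟩ := exists_X_pow_mem_jacobianIdeal hf hreg
    obtain ⟨v, hv⟩ := mem_jacobianIdeal.1 (hN 0)
    have h0 (i) : pderiv i f = 0 := (isHomogeneousInt_pderiv hf i).eq_zero (by simp)
    simp only [h0, mul_zero, Finset.sum_const_zero] at hv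
    exact absurd hv.symm (pow_ne_zero N (X_ne_zero 0))
  · exact h

theorem mem_jacobianIdeal_self [CharZero k] (hf : f.IsHomogeneous d) (hd : 0 < d) :
    f ∈ jacobianIdeal f := by
  have h := hf.sum_X_mul_pderiv
  have hd0 : (d : RatFunc k) ≠ 0 := Nat.cast_ne_zero.2 hd.ne'
  have h2 : (C ((d : RatFunc k)⁻¹) : Poly k n) * (d : Poly k n) = 1 := by
    rw [← map_natCast (C : RatFunc k →+* Poly k n) d, ← C_mul, inv_mul_cancel₀ hd0, C_1]
  have h3 : f = C ((d : RatFunc k)⁻¹) * ∑ i, X i * pderiv i f := by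
    rw [h, nsmul_eq_mul, ← mul_assoc, h2, one_mul]
  have h4 : ∑ i, X i * pderiv i f ∈ jacobianIdeal f := mem_jacobianIdeal.2 ⟨X, rfl⟩
  have h5 := Ideal.mul_mem_left _ (C ((d : RatFunc k)⁻¹)) h4
  rwa [← h3] at h5

/-- By the pigeonhole principle, a monomial of degree at least `(n + 1) * N` has an exponent that is
at least `N`. -/
theorem mem_jacobianIdeal_of_degree {N : ℕ} (hN : ∀ j, X j ^ N ∈ jacobianIdeal f)
    {p : Poly k n} {z : ℤ} (hp : IsHomogeneousInt p z) (hz : (n + 1) * (N : ℤ) ≤ z) :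
    p ∈ jacobianIdeal f := by
  rw [p.as_sum]
  refine sum_mem fun s hs => ?_
  have h := isHomogeneousInt_iff.1 hp s (mem_support_iff.1 hs)
  obtain ⟨i, hi⟩ : ∃ i, N ≤ s i := by
    by_contra! hlt
    have h1 : s.degree < ∑ i : Fin (n + 1), N := by
      rw [Finsupp.degree_eq_sum]
      exact Finset.sum_lt_sum_of_nonempty Finset.univ_nonempty fun i _ => hlt i
    simp only [Finset.sum_const, Finset.card_univ, Fintype.card_fin, smul_eq_mul] at h1
    have h2 : (s.degree : ℤ) < (n + 1) * N := by exact_mod_cast h1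
    omega
  have : monomial s (coeff s p) =
      monomial (s - Finsupp.single i N) (coeff s p) * X i ^ N := by
    rw [X_pow_eq_monomial, monomial_mul, mul_one, tsub_add_cancel_of_le]
    rwa [Finsupp.single_le_iff]
  rw [this]
  exact Ideal.mul_mem_left _ _ (hN i)

/-- Homogeneous syzygies of the partial derivatives are trivial. -/
theorem exists_homogeneous_alternating (hf : f.IsHomogeneous d)
    (hreg : Module.Finite (RatFunc k) (Poly k n ⧸ jacobianIdeal f)) {z : ℤ}
    {b : Fin (n + 1) → Poly k n} (hb : ∀ i, IsHomogeneousInt (b i) z)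
    (h0 : ∑ i, b i * pderiv i f = 0) :
    ∃ h : Fin (n + 1) → Fin (n + 1) → Poly k n, (∀ i, h i i = 0) ∧ (∀ i j, h i j = -h j i) ∧
      (∀ i j, IsHomogeneousInt (h i j) (z - ((d : ℤ) - 1))) ∧
      ∀ i, b i = ∑ j, h i j * pderiv j f := by
  obtain ⟨N, hN⟩ := exists_X_pow_mem_jacobianIdeal hf hreg
  obtain ⟨h, h1, h2, h3⟩ := exists_alternating_of_syzygy (fun i => pderiv i f) hN b h0
  refine ⟨fun i j => intComponent k n (z - ((d : ℤ) - 1)) (h i j), fun i => ?_, fun i j => ?_,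
    fun i j => isHomogeneousInt_intComponent _ _, fun i => ?_⟩
  · simp only [h1, map_zero]
  · simp only [← map_neg, ← h2]
  · rw [← intComponent_sum_mul_pderiv hf, ← h3, (hb i).intComponent_eq]

/-! ### Normal forms -/

variable {m : MonomialOrder (Fin (n + 1))} {B : Finset (Poly k n)}

variable (m B) in
/-- The space of reduced polynomials. -/
def reducedSubmodule : Submodule (RatFunc k) (Poly k n) where
  carrier := {r | IsReduced m B r}
  add_mem' := by
    intro p q hp hq s hs
    rcases Finset.mem_union.1 (support_add hs) with h | h
    · exact hp s h
    · exact hq s h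
  zero_mem' := by
    intro s hs
    simp at hs
  smul_mem' := by
    intro c p hp s hs
    exact hp s (support_smul hs)

theorem IsReduced.eq_zero {I : Ideal (Poly k n)} (hB : IsGroebnerBasis m B I) {r : Poly k n}
    (hr : IsReduced m B r) (hI : r ∈ I) : r = 0 := by
  by_contra h
  obtain ⟨g, hg, hg0, hle⟩ := hB.2 r hI h
  exact hr _ (m.degree_mem_support h) g hg hg0 hle

theorem exists_isDecomposition (hf : f.IsHomogeneous d)
    (hB : IsGroebnerBasis m B (jacobianIdeal f)) {a : Poly k n} {z : ℤ}
    (ha : IsHomogeneousInt a z) : ∃ r v, IsDecomposition m B f d z a r v := by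
  classical
  obtain ⟨g, r, hr, -, hred⟩ := m.div_set (B := {b | b ∈ B ∧ b ≠ 0})
    (fun b hb => (isUnit_iff_ne_zero.2 (m.leadingCoeff_ne_zero_iff.2 hb.2))) a
  have hg : a - r ∈ jacobianIdeal f := by
    rw [hr, add_sub_cancel_right, Finsupp.linearCombination_apply]
    exact sum_mem fun b _ => Ideal.mul_mem_left _ _ (hB.1 _ b.2.1)
  -- Division need not return a homogeneous remainder; its component of degree `z` is still reduced
  -- and still congruent to `a`.
  have h1 := intComponent_mem_jacobianIdeal hf hg z
  rw [map_sub, ha.intComponent_eq] at h1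
  have hr' := isHomogeneousInt_intComponent z r
  obtain ⟨v, hv, hsum⟩ := exists_homogeneous_cofactors hf h1 (ha.sub hr')
  refine ⟨intComponent k n z r, v, ?_, ?_, hr', hv⟩
  · rw [← hsum, add_sub_cancel]
  · intro s hs g hg hg0
    refine hred s ?_ g ⟨hg, hg0⟩
    rw [mem_support_iff, coeff_intComponent] at hs
    rw [mem_support_iff]
    exact fun h => hs (by simp [h])

end Jacobian

/-! ### Rational functions whose denominator is a power of `f` -/

theorem extendDerivation_div_pow {S R K : Type*} [CommRing S] [CommRing R] [IsDomain R]
    [Algebra S R] [Field K] [Algebra R K] [IsFractionRing R K] [Algebra S K] [IsScalarTower S R K]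
    (D : Derivation S R R) (a f : R) (hf : f ≠ 0) (l : ℕ) :
    extendDerivation K D (algebraMap R K a / algebraMap R K f ^ l) =
      algebraMap R K (f * D a - l * a * D f) / algebraMap R K f ^ (l + 1) := by
  have inj : Function.Injective (algebraMap R K) := IsFractionRing.injective R K
  have hfK : algebraMap R K f ≠ 0 := fun h0 => hf (inj (h0.trans (map_zero _).symm))
  rw [← map_pow, extendDerivation_div D _ _ (pow_ne_zero l hf), Derivation.leibniz_pow]
  rcases l with - | l
  · simp only [pow_zero, map_one, zero_smul, map_zero, mul_zero, sub_zero, Nat.cast_zero,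
      zero_mul, map_mul]
    field_simp
    simp
  · simp only [Nat.add_sub_cancel, smul_eq_mul, nsmul_eq_mul, map_mul, map_pow, map_sub,
      map_natCast]
    field_simp
    ring

section OverPow

variable {k : Type*} [Field k] {n d : ℕ} {f : Poly k n}

variable (f) in
/-- `overPow` as a linear map. -/
def overPowLin (l : ℕ) : Poly k n →ₗ[RatFunc k] Frac k n where
  toFun a := overPow f a l
  map_add' a b := by simp only [overPow, map_add, add_div]
  map_smul' c a := by
    simp only [overPow, RingHom.id_apply, Algebra.smul_def, map_mul, mul_div_assoc]
    rw [← IsScalarTower.algebraMap_apply]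

theorem overPow_add (a b : Poly k n) (l : ℕ) :
    overPow f (a + b) l = overPow f a l + overPow f b l :=
  (overPowLin f l).map_add a b

theorem overPow_sub (a b : Poly k n) (l : ℕ) :
    overPow f (a - b) l = overPow f a l - overPow f b l :=
  (overPowLin f l).map_sub a b

theorem overPow_zero (l : ℕ) : overPow f 0 l = 0 :=
  (overPowLin f l).map_zero

theorem overPow_smul (c : RatFunc k) (a : Poly k n) (l : ℕ) :
    overPow f (c • a) l = c • overPow f a l :=
  (overPowLin f l).map_smul c a

theorem overPow_sum {ι : Type*} (s : Finset ι) (a : ι → Poly k n) (l : ℕ) :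
    overPow f (∑ i ∈ s, a i) l = ∑ i ∈ s, overPow f (a i) l :=
  map_sum (overPowLin f l) a s

theorem algebraMap_frac_ne_zero (hf0 : f ≠ 0) : algebraMap (Poly k n) (Frac k n) f ≠ 0 :=
  fun h => hf0 (IsFractionRing.injective (Poly k n) (Frac k n) (h.trans (map_zero _).symm))

theorem overPow_inj (hf0 : f ≠ 0) {a b : Poly k n} {l : ℕ} :
    overPow f a l = overPow f b l ↔ a = b := by
  refine ⟨fun h => ?_, fun h => by rw [h]⟩
  unfold overPow at h
  rw [div_left_inj' (pow_ne_zero l (algebraMap_frac_ne_zero hf0))] at h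
  exact IsFractionRing.injective (Poly k n) (Frac k n) h

theorem overPow_mul_pow (hf0 : f ≠ 0) (a : Poly k n) (l j : ℕ) :
    overPow f (a * f ^ j) (l + j) = overPow f a l := by
  unfold overPow
  rw [map_mul, map_pow, pow_add, mul_div_mul_right _ _
    (pow_ne_zero j (algebraMap_frac_ne_zero hf0))]

theorem overPow_mul_self (hf0 : f ≠ 0) (a : Poly k n) (l : ℕ) :
    overPow f (a * f) (l + 1) = overPow f a l := by
  simpa using overPow_mul_pow hf0 a l 1

theorem dx_overPow (hf0 : f ≠ 0) (i : Fin (n + 1)) (a : Poly k n) (l : ℕ) :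
    dx k n i (overPow f a l) = overPow f (f * pderiv i a - l * a * pderiv i f) (l + 1) :=
  extendDerivation_div_pow _ _ _ hf0 _

theorem dt_overPow (hf0 : f ≠ 0) (a : Poly k n) (l : ℕ) :
    dt k n (overPow f a l) = overPow f (f * coeffDerivation (ratDeriv k) a -
      l * a * coeffDerivation (ratDeriv k) f) (l + 1) :=
  extendDerivation_div_pow _ _ _ hf0 _

theorem dt_dx_overPow (hf0 : f ≠ 0) (i : Fin (n + 1)) (a : Poly k n) (l : ℕ) :
    dt k n (dx k n i (overPow f a l)) = dx k n i (dt k n (overPow f a l)) := by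
  rw [dx_overPow hf0, dt_overPow hf0, dt_overPow hf0, dx_overPow hf0, overPow_inj hf0]
  simp only [map_sub, Derivation.leibniz, smul_eq_mul, Derivation.map_natCast,
    coeffDerivation_pderiv]
  push_cast
  ring

theorem sum_dx_overPow (hf0 : f ≠ 0) (b : Fin (n + 1) → Poly k n) (s : ℕ) :
    ∑ i, dx k n i (overPow f (b i) s) =
      overPow f ((∑ i, pderiv i (b i)) * f - s * ∑ i, b i * pderiv i f) (s + 1) := by
  simp only [dx_overPow hf0]
  rw [← overPow_sum, Finset.sum_sub_distrib, Finset.sum_mul, Finset.mul_sum]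
  congr 2
  · exact Finset.sum_congr rfl fun _ _ => mul_comm _ _
  · exact Finset.sum_congr rfl fun _ _ => by ring

/-- The denominator of an element of `L[x, 1/f]_z` may be raised. -/
theorem exists_overPow_add (hf : f.IsHomogeneous d) (hf0 : f ≠ 0) {a : Poly k n} {z : ℤ} {l : ℕ}
    (ha : IsHomogeneousInt a (z + l * d)) (j : ℕ) :
    ∃ b : Poly k n, IsHomogeneousInt b (z + (l + j : ℕ) * d) ∧
      overPow f a l = overPow f b (l + j) := by
  refine ⟨a * f ^ j, ?_, (overPow_mul_pow hf0 a l j).symm⟩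
  have := ha.mul (IsHomogeneousInt.pow hf j)
  convert this using 1
  push_cast
  ring

/-- `L[x, 1/f]_z` as a vector space. -/
def fractionSubmodule (hf : f.IsHomogeneous d) (hf0 : f ≠ 0) (z : ℤ) :
    Submodule (RatFunc k) (Frac k n) where
  carrier := homogeneousFractions f d z
  add_mem' := by
    rintro _ _ ⟨l, a, ha, rfl⟩ ⟨l', a', ha', rfl⟩
    obtain ⟨b, hb, e⟩ := exists_overPow_add hf hf0 ha l'
    obtain ⟨b', hb', e'⟩ := exists_overPow_add hf hf0 ha' l
    rw [add_comm l' l] at hb' e'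
    exact ⟨l + l', b + b', hb.add hb', by rw [e, e', overPow_add]⟩
  zero_mem' := ⟨0, 0, .zero, (overPow_zero 0).symm⟩
  smul_mem' := by
    rintro c _ ⟨l, a, ha, rfl⟩
    exact ⟨l, c • a, ha.smul c, (overPow_smul c a l).symm⟩

/-- `D_f` as a vector space. -/
def exactSubmodule (hf : f.IsHomogeneous d) (hf0 : f ≠ 0) :
    Submodule (RatFunc k) (Frac k n) where
  carrier := exactFractions f d
  add_mem' := by
    rintro _ _ ⟨A, hA, rfl⟩ ⟨A', hA', rfl⟩
    refine ⟨A + A', fun i => (fractionSubmodule hf hf0 _).add_mem (hA i) (hA' i), ?_⟩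
    simp only [Pi.add_apply, map_add, Finset.sum_add_distrib]
  zero_mem' := ⟨0, fun i => (fractionSubmodule hf hf0 _).zero_mem, by simp⟩
  smul_mem' := by
    rintro c _ ⟨A, hA, rfl⟩
    refine ⟨c • A, fun i => (fractionSubmodule hf hf0 _).smul_mem c (hA i), ?_⟩
    simp only [Pi.smul_apply, Derivation.map_smul, Finset.smul_sum]

theorem dt_mem_homogeneousFractions (hf : f.IsHomogeneous d) (hf0 : f ≠ 0) {z : ℤ} {G : Frac k n}
    (hG : G ∈ homogeneousFractions f d z) : dt k n G ∈ homogeneousFractions f d z := by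
  obtain ⟨l, a, ha, rfl⟩ := hG
  refine ⟨l + 1, _, ?_, dt_overPow hf0 a l⟩
  have hf' := isHomogeneousInt_natCast.2 hf
  have h1 := hf'.mul (ha.coeffDerivation (ratDeriv k))
  have h2 := (ha.C_mul l).mul (hf'.coeffDerivation (ratDeriv k))
  rw [map_natCast] at h2
  convert h1.sub (by convert h2 using 1; ring) using 1
  push_cast
  ring

theorem dt_mem_exactFractions (hf : f.IsHomogeneous d) (hf0 : f ≠ 0) {G : Frac k n}
    (hG : G ∈ exactFractions f d) : dt k n G ∈ exactFractions f d := by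
  obtain ⟨A, hA, rfl⟩ := hG
  refine ⟨fun i => dt k n (A i), fun i => dt_mem_homogeneousFractions hf hf0 (hA i), ?_⟩
  rw [map_sum]
  refine Finset.sum_congr rfl fun i _ => ?_
  obtain ⟨l, a, -, h⟩ := hA i
  rw [h, dt_dx_overPow hf0, ← h]

theorem exists_isWrittenAs (hf : f.IsHomogeneous d) (hf0 : f ≠ 0) {G : Frac k n}
    (hG : G ∈ homogeneousFractions f d (-(n : ℤ) - 1)) : ∃ l a, IsWrittenAs f d G l a := by
  obtain ⟨l, a, ha, rfl⟩ := hG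
  obtain ⟨b, hb, e⟩ := exists_overPow_add hf hf0 ha 1
  refine ⟨l + 1, b, by omega, ?_, e⟩
  convert hb using 1
  ring

/-- The elements of `D_f` whose certificates have the denominator `f ^ s`. -/
def IsExactAt (f : Poly k n) (d s : ℕ) (G : Frac k n) : Prop :=
  ∃ b : Fin (n + 1) → Poly k n, (∀ i, IsHomogeneousInt (b i) (-(n : ℤ) + s * d)) ∧
    G = ∑ i, dx k n i (overPow f (b i) s)

theorem IsExactAt.add (hf : f.IsHomogeneous d) (hf0 : f ≠ 0) {s : ℕ} {G : Frac k n}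
    (h : IsExactAt f d s G) (j : ℕ) : IsExactAt f d (s + j) G := by
  obtain ⟨b, hb, rfl⟩ := h
  choose c hc e using fun i => exists_overPow_add hf hf0 (hb i) j
  exact ⟨c, hc, Finset.sum_congr rfl fun i _ => by rw [e]⟩

theorem exists_isExactAt (hf : f.IsHomogeneous d) (hf0 : f ≠ 0) {G : Frac k n}
    (hG : G ∈ exactFractions f d) : ∃ s, IsExactAt f d s G := by
  obtain ⟨A, hA, rfl⟩ := hG
  choose l a ha e using hA
  have h (i) : ∃ b, IsHomogeneousInt b (-(n : ℤ) + (∑ j, l j : ℕ) * d) ∧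
      A i = overPow f b (∑ j, l j) := by
    obtain ⟨b, hb, e'⟩ := exists_overPow_add hf hf0 (ha i) (∑ j ∈ Finset.univ.erase i, l j)
    rw [Finset.add_sum_erase _ _ (Finset.mem_univ i)] at hb e'
    exact ⟨b, hb, (e i).trans e'⟩
  choose b hb e' using h
  exact ⟨_, b, hb, Finset.sum_congr rfl fun i _ => by rw [e']⟩

theorem IsExactAt.mem {s : ℕ} {G : Frac k n} (h : IsExactAt f d s G) : G ∈ exactFractions f d := by
  obtain ⟨b, hb, rfl⟩ := h
  exact ⟨_, fun i => ⟨s, b i, hb i, rfl⟩, rfl⟩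

end OverPow

/-! ### The Griffiths–Dwork reduction -/

section Griffiths

variable {k : Type*} [Field k] {n d : ℕ} {f : Poly k n}

theorem sum_sum_alternating_eq_zero [CharZero k] {h g : Fin (n + 1) → Fin (n + 1) → Poly k n}
    (hh : ∀ i j, h i j = -h j i) (hg : ∀ i j, g i j = g j i) : ∑ i, ∑ j, h i j * g i j = 0 := by
  have : ∑ i, ∑ j, h i j * g i j = -∑ i, ∑ j, h i j * g i j := by
    conv_lhs => rw [Finset.sum_comm]
    simp only [← Finset.sum_neg_distrib]
    exact Finset.sum_congr rfl fun i _ => Finset.sum_congr rfl fun j _ => by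
      rw [hh j i, hg j i, neg_mul]
  exact self_eq_neg.1 this

theorem natCast_mul_C_inv [CharZero k] {s : ℕ} (hs : s ≠ 0) :
    (s : Poly k n) * C ((s : RatFunc k)⁻¹) = 1 := by
  have h0 : (s : RatFunc k) ≠ 0 := Nat.cast_ne_zero.2 hs
  rw [← map_natCast (C : RatFunc k →+* Poly k n) s, ← C_mul, mul_inv_cancel₀ h0, C_1]

/-- If the pole order of `∑ᵢ ∂ᵢ(bᵢ / f ^ s)` is at most `s`, then this function is a sum
`∑ᵢ ∂ᵢ(cᵢ / f ^ (s - 1))`. -/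
theorem IsExactAt.of_overPow [CharZero k] (hf : f.IsHomogeneous d)
    (hreg : Module.Finite (RatFunc k) (Poly k n ⧸ jacobianIdeal f)) {s : ℕ} {a : Poly k n}
    (h : IsExactAt f d (s + 1) (overPow f a (s + 1))) :
    IsExactAt f d s (overPow f a (s + 1)) := by
  have hf0 := ne_zero_of_finite hf hreg
  have hd := degree_pos_of_finite hf hreg
  have hf' := isHomogeneousInt_natCast.2 hf
  obtain ⟨b, hb, e⟩ := h
  set z : ℤ := -(n : ℤ) + (s + 1 : ℕ) * d with hz
  rw [sum_dx_overPow hf0, ← overPow_mul_self hf0, overPow_inj hf0] at e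
  have hs1 := natCast_mul_C_inv (k := k) (n := n) (Nat.succ_ne_zero s)
  rw [Nat.succ_eq_add_one] at hs1
  have hd1 := natCast_mul_C_inv (k := k) (n := n) hd.ne'
  set u : Poly k n := C (((s + 1 : ℕ) : RatFunc k)⁻¹)
  set w : Poly k n := C ((d : RatFunc k)⁻¹) with hw
  -- Comparing numerators over `f ^ (s + 2)`, with `s + 1` invertible, shows that `f` divides `∑ᵢ bᵢ
  -- ∂ᵢf`.
  obtain ⟨c, hc, ec⟩ : ∃ c, IsHomogeneousInt c (z - 1) ∧ ∑ i, b i * pderiv i f = f * c := by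
    have h1 : ∑ i, b i * pderiv i f = f * (u * (∑ i, pderiv i (b i) - a)) := by
      linear_combination u * e - (∑ i, b i * pderiv i f) * hs1
    have h2 : IsHomogeneousInt (∑ i, b i * pderiv i f) (z + (d - 1)) :=
      .sum fun i _ => (hb i).mul (isHomogeneousInt_pderiv hf i)
    refine ⟨intComponent k n (z - 1) (u * (∑ i, pderiv i (b i) - a)),
      isHomogeneousInt_intComponent _ _, ?_⟩
    have h3 : z + ((d : ℤ) - 1) - d = z - 1 := by ring
    rw [← h2.intComponent_eq, h1, intComponent_mul hf', h3]
  have he : IsHomogeneousInt (w * c) (z - 1) := hc.C_mul _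
  set e' : Poly k n := w * c
  have eulerf : ∑ i, X i * pderiv i f = (d : Poly k n) * f := by
    rw [hf'.sum_X_mul_pderiv, Int.cast_natCast]
  -- By Euler's identity, subtracting `(c / d) Xᵢ` from `bᵢ` leaves a syzygy of the partial
  -- derivatives.
  obtain ⟨h, h1, h2, h3, h4⟩ := exists_homogeneous_alternating hf hreg (z := z)
    (b := fun i => b i - e' * X i)
    (fun i => (hb i).sub (by
      have := he.mul (isHomogeneousInt_natCast.2 (isHomogeneous_X (RatFunc k) i))
      convert this using 1
      push_cast
      ring)) (by
      simp only [sub_mul, Finset.sum_sub_distrib, mul_assoc]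
      rw [← Finset.mul_sum, eulerf, ec]
      linear_combination (-f * c) * hd1)
  have hb' (i) : b i = e' * X i + ∑ j, h i j * pderiv j f := by
    rw [← h4, add_sub_cancel]
  -- The Euler part has divergence `(n + 1 + deg e') e'`, and `n + 1 + (z - 1) = (s + 1) d`. This
  -- cancels against `hcontr` below. The terms with second derivatives of `f` vanish, since `h` is
  -- alternating and the Hessian is symmetric.
  have hdiv : ∑ i, pderiv i (b i) =
      ((s + 1 : ℕ) * d : Poly k n) * e' + ∑ j, (∑ i, pderiv i (h i j)) * pderiv j f := by
    have eulere := he.sum_X_mul_pderiv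
    have hsym := sum_sum_alternating_eq_zero (g := fun i j => pderiv i (pderiv j f)) h2
      (fun i j => pderiv_pderiv_comm i j f)
    have hX : ∑ i : Fin (n + 1), e' * pderiv i (X i : Poly k n) = (n + 1 : Poly k n) * e' := by
      simp [mul_comm]
    have hc : ∑ j, (∑ i, pderiv i (h i j)) * pderiv j f =
        ∑ i, ∑ j, pderiv j f * pderiv i (h i j) := by
      rw [Finset.sum_comm]
      simp only [Finset.mul_sum, mul_comm]
    simp only [hb', map_add, map_sum, Derivation.leibniz, smul_eq_mul, Finset.sum_add_distrib]
    rw [hX, hsym, eulere, hc, hz]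
    push_cast
    ring
  have hcontr : ∑ i, b i * pderiv i f = d * e' * f := by
    rw [ec]
    linear_combination (-f * c) * hd1
  rw [hdiv, hcontr] at e
  have ea : a = ∑ j, (∑ i, pderiv i (h i j)) * pderiv j f := by
    apply mul_right_cancel₀ hf0
    rw [e]
    ring
  -- The new certificate is proportional to `∑ᵢ ∂ᵢ(h i j)`. It has divergence zero, so
  -- differentiating it over `f ^ s` leaves only the term of pole order `s + 1`.
  have hdd : ∑ j, pderiv j (∑ i, pderiv i (h i j)) = 0 := by
    simp only [map_sum]
    rw [Finset.sum_comm]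
    have : ∑ i, ∑ j, pderiv j (pderiv i (h i j)) = -∑ i, ∑ j, pderiv j (pderiv i (h i j)) := by
      conv_lhs => rw [Finset.sum_comm]
      simp only [← Finset.sum_neg_distrib]
      exact Finset.sum_congr rfl fun i _ => Finset.sum_congr rfl fun j _ => by
        rw [h2 j i, map_neg, map_neg, pderiv_pderiv_comm]
    exact self_eq_neg.1 this
  -- For `s = 0` one cannot divide by `s`; instead `h i j` has degree `1 - n`, so its derivatives
  -- vanish for `n > 0`, while for `n = 0` only the zero diagonal entry exists.
  rcases Nat.eq_zero_or_pos s with rfl | hs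
  · refine ⟨0, fun i => .zero, ?_⟩
    have h0 (i j) : pderiv i (h i j) = 0 := by
      by_cases hn : n = 0
      · subst hn
        obtain rfl : i = j := Fin.ext (by omega)
        rw [h1, map_zero]
      · refine ((h3 i j).pderiv i).eq_zero ?_
        rw [hz]
        push_cast
        have : (0 : ℤ) < n := by exact_mod_cast Nat.pos_of_ne_zero hn
        linarith
    rw [ea]
    simp [h0, overPow_zero]
  · have hs2 := natCast_mul_C_inv (k := k) (n := n) hs.ne'
    refine ⟨fun j => C (-(s : RatFunc k)⁻¹) * ∑ i, pderiv i (h i j), fun j => ?_, ?_⟩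
    · refine .C_mul _ (.sum fun i _ => ?_)
      convert (h3 i j).pderiv i using 1
      rw [hz]
      push_cast
      ring
    · rw [sum_dx_overPow hf0, overPow_inj hf0]
      simp only [pderiv_C_mul, ← Finset.mul_sum, mul_assoc]
      rw [hdd, ← ea, C_neg]
      linear_combination (-a) * hs2

/-- The pole order of the certificate is lowered one step at a time, after writing the function as
`a * f ^ j` over the current power of `f`. -/
theorem IsExactAt.of_overPow_le [CharZero k] (hf : f.IsHomogeneous d)
    (hreg : Module.Finite (RatFunc k) (Poly k n ⧸ jacobianIdeal f)) {l : ℕ} {a : Poly k n}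
    (s : ℕ) (h : IsExactAt f d s (overPow f a (l + 1))) :
    IsExactAt f d l (overPow f a (l + 1)) := by
  have hf0 := ne_zero_of_finite hf hreg
  induction s with
  | zero => simpa using h.add hf hf0 l
  | succ s ih =>
    by_cases hs : s + 1 ≤ l
    · obtain ⟨j, rfl⟩ := Nat.exists_eq_add_of_le hs
      exact h.add hf hf0 j
    · refine ih ?_
      obtain ⟨j, rfl⟩ := Nat.exists_eq_add_of_le (by omega : l ≤ s)
      have e := overPow_mul_pow hf0 a (l + 1) j
      rw [add_right_comm] at e
      rw [← e] at h ⊢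
      exact h.of_overPow hf hreg

variable {m : MonomialOrder (Fin (n + 1))} {B : Finset (Poly k n)}

variable (d f m B) in
/-- The space of the summands `r / f ^ l` of the results of the reduction. -/
def normalTerms (l : ℕ) : Submodule (RatFunc k) (Frac k n) :=
  if l = 1 then (homogeneousInt k n ((l : ℤ) * d - (n + 1))).map (overPowLin f l)
  else (homogeneousInt k n ((l : ℤ) * d - (n + 1)) ⊓ reducedSubmodule m B).map (overPowLin f l)

theorem mem_normalTerms {l : ℕ} {G : Frac k n} : G ∈ normalTerms d f m B l ↔
    ∃ r, IsHomogeneousInt r ((l : ℤ) * d - (n + 1)) ∧ (l ≠ 1 → IsReduced m B r) ∧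
      G = overPow f r l := by
  unfold normalTerms
  split_ifs with h
  · constructor
    · rintro ⟨r, hr, rfl⟩
      exact ⟨r, hr, fun h' => absurd h h', rfl⟩
    · rintro ⟨r, hr, -, rfl⟩
      exact ⟨r, hr, rfl⟩
  · constructor
    · rintro ⟨r, hr, rfl⟩
      exact ⟨r, hr.1, fun _ => hr.2, rfl⟩
    · rintro ⟨r, hr, hr', rfl⟩
      exact ⟨r, ⟨hr, hr' h⟩, rfl⟩

variable (d f m B) in
/-- The space of results of the reduction with pole order at most `M`. -/
def normalForms : ℕ → Submodule (RatFunc k) (Frac k n)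
  | 0 => ⊥
  | M + 1 => normalForms M ⊔ normalTerms d f m B (M + 1)

theorem exists_overPow_of_mem_normalForms (hf : f.IsHomogeneous d) (hf0 : f ≠ 0) {M : ℕ}
    {G : Frac k n} (hG : G ∈ normalForms d f m B M) :
    ∃ a, IsHomogeneousInt a (-(n : ℤ) - 1 + M * d) ∧ G = overPow f a M := by
  induction M generalizing G with
  | zero =>
    obtain rfl : G = 0 := hG
    exact ⟨0, .zero, (overPow_zero 0).symm⟩
  | succ M ih =>
    obtain ⟨G', hG', r, hr, rfl⟩ := Submodule.mem_sup.1 hG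
    obtain ⟨a, ha, rfl⟩ := ih hG'
    obtain ⟨r, hr', -, rfl⟩ := mem_normalTerms.1 hr
    obtain ⟨b, hb, e⟩ := exists_overPow_add hf hf0 ha 1
    refine ⟨b + r, hb.add (by convert hr' using 1; push_cast; ring), ?_⟩
    rw [overPow_add, e]

/-- A result of the reduction that lies in `D_f` is zero. -/
theorem eq_zero_of_mem_normalForms [CharZero k] (hf : f.IsHomogeneous d)
    (hreg : Module.Finite (RatFunc k) (Poly k n ⧸ jacobianIdeal f))
    (hB : IsGroebnerBasis m B (jacobianIdeal f)) {M : ℕ} {G : Frac k n}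
    (hG : G ∈ normalForms d f m B M) (hD : G ∈ exactFractions f d) : G = 0 := by
  have hf0 := ne_zero_of_finite hf hreg
  have hd := degree_pos_of_finite hf hreg
  induction M generalizing G with
  | zero => exact hG
  | succ M ih =>
    obtain ⟨G', hG', r, hr, rfl⟩ := Submodule.mem_sup.1 hG
    obtain ⟨a, ha, rfl⟩ := exists_overPow_of_mem_normalForms hf hf0 hG'
    obtain ⟨r, hr, hred, rfl⟩ := mem_normalTerms.1 hr
    have e : overPow f a M + overPow f r (M + 1) = overPow f (a * f + r) (M + 1) := by
      rw [overPow_add, overPow_mul_self hf0]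
    obtain ⟨s, hs⟩ := exists_isExactAt hf hf0 hD
    have hs' := hs
    rw [e] at hs'
    obtain ⟨b, hb, e'⟩ := hs'.of_overPow_le hf hreg
    rw [sum_dx_overPow hf0] at e'
    -- A numerator over `f` itself need not be reduced. In this case the certificates are
    -- polynomials of degree `-n`, whose derivatives have negative degree and vanish.
    rcases Nat.eq_zero_or_pos M with rfl | hM
    · rw [e, e']
      have h0 (i) : pderiv i (b i) = 0 := ((hb i).pderiv i).eq_zero (by push_cast; omega)
      simp [h0, overPow_zero]
    · rw [overPow_inj hf0] at e'
      -- The numerators of pole order `M + 1` agree modulo the Jacobian ideal, which contains `f` by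
      -- Euler's identity.
      have hJ : r ∈ jacobianIdeal f := by
        have : r = (∑ i, pderiv i (b i) - a) * f - M * ∑ i, b i * pderiv i f := by
          linear_combination e'
        rw [this]
        exact sub_mem (Ideal.mul_mem_left _ _ (mem_jacobianIdeal_self hf hd))
          (Ideal.mul_mem_left _ _ (mem_jacobianIdeal.2 ⟨b, rfl⟩))
      obtain rfl := (hred (by omega)).eq_zero hB hJ
      rw [overPow_zero, add_zero] at hD ⊢
      exact ih hG' hD

/-- For `l` beyond the bound, `d ≥ 1` gives `l * d - (n + 1) ≥ (n + 1) * N`; a numerator of that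
degree lies in the Jacobian ideal, and if reduced it is zero. -/
theorem exists_normalTerms_le (hf : f.IsHomogeneous d)
    (hreg : Module.Finite (RatFunc k) (Poly k n ⧸ jacobianIdeal f))
    (hB : IsGroebnerBasis m B (jacobianIdeal f)) :
    ∃ M, ∀ l, 1 ≤ l → normalTerms d f m B l ≤ normalForms d f m B M := by
  have hd := degree_pos_of_finite hf hreg
  obtain ⟨N, hN⟩ := exists_X_pow_mem_jacobianIdeal hf hreg
  have hmono : Monotone (normalForms d f m B) := monotone_nat_of_le_succ fun M => le_sup_left
  refine ⟨(n + 1) * N + n + 1, fun l hl => ?_⟩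
  by_cases h : l ≤ (n + 1) * N + n + 1
  · obtain ⟨l, rfl⟩ : ∃ j, l = j + 1 := ⟨l - 1, by omega⟩
    exact le_sup_right.trans (hmono h)
  · intro G hG
    obtain ⟨r, hr, hred, rfl⟩ := mem_normalTerms.1 hG
    have hz : ((n : ℤ) + 1) * N ≤ (l : ℤ) * d - (n + 1) := by
      have h1 : (n + 1) * N + n + 1 ≤ l * d := by nlinarith
      zify at h1
      linarith
    rw [(hred (by omega)).eq_zero hB (mem_jacobianIdeal_of_degree hN hr hz), overPow_zero]
    exact zero_mem _

instance (M : ℕ) : Module.Finite (RatFunc k) (normalForms d f m B M) := by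
  have h (l : ℕ) : Module.Finite (RatFunc k) (normalTerms d f m B l) := by
    have : normalTerms d f m B l ≤
        (homogeneousInt k n ((l : ℤ) * d - (n + 1))).map (overPowLin f l) := by
      intro G hG
      obtain ⟨r, hr, -, rfl⟩ := mem_normalTerms.1 hG
      exact ⟨r, hr, rfl⟩
    exact Submodule.finiteDimensional_of_le this
  induction M with
  | zero => exact inferInstanceAs (Module.Finite (RatFunc k) (⊥ : Submodule (RatFunc k) (Frac k n)))
  | succ M ih => exact Submodule.finiteDimensional_sup _ _

/-- One step of the reduction does not change the class modulo `D_f`. -/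
theorem sub_mem_exactFractions_of_isDecomposition [CharZero k]
    (hf0 : f ≠ 0) {l : ℕ} (hl : 1 ≤ l)
    {a r : Poly k n} {v : Fin (n + 1) → Poly k n}
    (h : IsDecomposition m B f d (((l + 1 : ℕ) : ℤ) * d - (n + 1)) a r v) :
    overPow f r (l + 1) + overPow f (C ((l : RatFunc k)⁻¹) * ∑ j, pderiv j (v j)) l -
      overPow f a (l + 1) ∈ exactFractions f d := by
  obtain ⟨ha, -, -, hv⟩ := h
  refine IsExactAt.mem (s := l) ⟨fun i => C ((l : RatFunc k)⁻¹) * v i, fun i => ?_, ?_⟩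
  · convert (hv i).C_mul _ using 1
    push_cast
    ring
  · rw [sum_dx_overPow hf0, ← overPow_mul_self hf0 (C _ * _), ← overPow_add, ← overPow_sub,
      overPow_inj hf0, ha]
    simp only [pderiv_C_mul, ← Finset.mul_sum, mul_assoc]
    linear_combination (∑ i, v i * pderiv i f) *
      natCast_mul_C_inv (k := k) (n := n) (by omega : l ≠ 0)

end Griffiths

/-! ### Denominators -/

section Denominators

variable {R : Type*} [CommRing R] [IsDomain R] [UniqueFactorizationMonoid R]

theorem exists_dvd_pow_of_irreducible {f : R} (q : R) :
    q ≠ 0 → (∀ p, Irreducible p → p ∣ q → p ∣ f) → ∃ N, q ∣ f ^ N := by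
  induction q using UniqueFactorizationMonoid.induction_on_prime with
  | h₁ => exact fun h => absurd rfl h
  | h₂ x hx => exact fun _ _ => ⟨0, hx.dvd⟩
  | h₃ a p ha hp ih =>
    intro _ h
    obtain ⟨N, hN⟩ := ih ha fun p' hp' hd => h p' hp' (hd.mul_left p)
    exact ⟨N + 1, by rw [pow_succ']; exact mul_dvd_mul (h p hp.irreducible (dvd_mul_right p a)) hN⟩

/-- With `q` the reduced denominator of `F`, the factor `f₁` collects the primes of `f` that a
regular certificate may have as poles. -/
theorem exists_eq_mul_isRelPrime (q f : R) :
    f ≠ 0 → ∃ f₁ f₂, f = f₁ * f₂ ∧ (∀ p, Irreducible p → p ∣ f₁ → p ∣ q) ∧ IsRelPrime f₂ q := by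
  induction f using UniqueFactorizationMonoid.induction_on_prime with
  | h₁ => exact fun h => absurd rfl h
  | h₂ x hx =>
    exact fun _ => ⟨1, x, (one_mul x).symm,
      fun p hp h => absurd (isUnit_of_dvd_one h) hp.not_isUnit, hx.isRelPrime_left⟩
  | h₃ a p ha hp ih =>
    intro _
    obtain ⟨f₁, f₂, rfl, h1, h2⟩ := ih ha
    by_cases hpq : p ∣ q
    · refine ⟨p * f₁, f₂, (mul_assoc _ _ _).symm, fun p' hp' hd => ?_, h2⟩
      rcases (UniqueFactorizationMonoid.irreducible_iff_prime.1 hp').dvd_or_dvd hd with h | h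
      · exact (((hp'.associated_of_dvd hp.irreducible h).symm.dvd_iff_dvd_left).1 hpq)
      · exact h1 p' hp' h
    · exact ⟨f₁, p * f₂, mul_left_comm _ _ _, h1,
        IsRelPrime.mul_left ((hp.irreducible.isRelPrime_iff_not_dvd).2 hpq) h2⟩

end Denominators

/-! ### Regular certificates and `D_f` -/

section Regular

variable {k : Type*} [Field k] {n d : ℕ} {f : Poly k n}

theorem den_dvd_pow (hf0 : f ≠ 0) (a : Poly k n) (l : ℕ) :
    (IsFractionRing.den (Poly k n) (overPow f a l) : Poly k n) ∣ f ^ l := by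
  set F := overPow f a l with hF
  have h1 := IsFractionRing.mk'_num_den' (Poly k n) F
  have hq := algebraMap_frac_ne_zero
    (nonZeroDivisors.coe_ne_zero (IsFractionRing.den (Poly k n) F))
  have hfl := pow_ne_zero l (algebraMap_frac_ne_zero hf0)
  have h2 := h1.trans hF
  unfold overPow at h2
  rw [div_eq_div_iff hq hfl, ← map_pow, ← map_mul, ← map_mul] at h2
  have h3 := IsFractionRing.injective (Poly k n) (Frac k n) h2
  refine (IsFractionRing.num_den_reduced (Poly k n) F).symm.dvd_of_dvd_mul_left ?_
  exact ⟨a, by rw [h3, mul_comm]⟩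

theorem exists_overPow_of_den_dvd (hf0 : f ≠ 0) {F : Frac k n} {l : ℕ}
    (h : (IsFractionRing.den (Poly k n) F : Poly k n) ∣ f ^ l) : ∃ a, F = overPow f a l := by
  obtain ⟨c, hc⟩ := h
  refine ⟨IsFractionRing.num (Poly k n) F * c, ?_⟩
  have h1 := IsFractionRing.mk'_num_den' (Poly k n) F
  have hq := algebraMap_frac_ne_zero
    (nonZeroDivisors.coe_ne_zero (IsFractionRing.den (Poly k n) F))
  have hc0 : c ≠ 0 := by
    rintro rfl
    exact pow_ne_zero l hf0 (by rw [hc, mul_zero])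
  unfold overPow
  rw [← map_pow, hc, map_mul, map_mul, mul_div_mul_right _ _ (algebraMap_frac_ne_zero hc0), h1]

theorem apply_mem_homogeneousFractions (hf : f.IsHomogeneous d) (hf0 : f ≠ 0) {z : ℤ}
    {F : Frac k n} (hF : F ∈ homogeneousFractions f d z) (T : DiffOp k) :
    T.apply F ∈ homogeneousFractions f d z := by
  refine (fractionSubmodule hf hf0 z).sum_mem fun j _ => Submodule.smul_mem _ _ ?_
  change (dt k n)^[j] F ∈ homogeneousFractions f d z
  clear * - hF hf hf0
  induction j with
  | zero => exact hF
  | succ j ih =>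
    rw [Function.iterate_succ_apply']
    exact dt_mem_homogeneousFractions hf hf0 ih

/-- A sum `∑ᵢ ∂ᵢAᵢ` with `Aᵢ` in `L[x, 1/f]` that is homogeneous of degree `-n-1` lies in `D_f`. -/
theorem mem_exactFractions_of_overPow (hf : f.IsHomogeneous d) (hf0 : f ≠ 0) {G : Frac k n}
    (hG : G ∈ homogeneousFractions f d (-(n : ℤ) - 1)) {A : Fin (n + 1) → Frac k n}
    (hA : ∀ i, ∃ l a, A i = overPow f a l) (h : G = ∑ i, dx k n i (A i)) :
    G ∈ exactFractions f d := by
  obtain ⟨M, g, hg, eG⟩ := hG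
  choose l a e using hA
  set N := M + ∑ j, l j with hN
  have hc (i) : ∃ c, A i = overPow f c N := by
    have : l i ≤ N := (Finset.single_le_sum (fun _ _ => Nat.zero_le _)
      (Finset.mem_univ i)).trans (Nat.le_add_left _ M)
    obtain ⟨j, hj⟩ := Nat.exists_eq_add_of_le this
    exact ⟨a i * f ^ j, by rw [e, hj, overPow_mul_pow hf0]⟩
  choose c hc using hc
  obtain ⟨g', hg', eg'⟩ := exists_overPow_add hf hf0 hg (∑ j, l j + 1)
  rw [← add_assoc, ← hN] at hg' eg'
  have key : g' = (∑ i, pderiv i (c i)) * f - N * ∑ i, c i * pderiv i f := by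
    rw [← overPow_inj hf0 (l := N + 1), ← eg', ← sum_dx_overPow hf0, ← eG, h]
    simp only [hc]
  have hz : -(n : ℤ) - 1 + (N + 1 : ℕ) * d - d + 1 = -(n : ℤ) + N * d := by
    push_cast
    ring
  -- The operator `∑ᵢ ∂ᵢ` is graded, so only the components of degree `-n` of the certificates
  -- contribute to a function of degree `-n - 1`.
  refine IsExactAt.mem (s := N) ⟨fun i => intComponent k n (-(n : ℤ) + N * d) (c i),
    fun i => isHomogeneousInt_intComponent _ _, ?_⟩
  rw [sum_dx_overPow hf0, eG, eg', overPow_inj hf0, ← hg'.intComponent_eq, key, map_sub,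
    mul_comm _ f, intComponent_mul (isHomogeneousInt_natCast.2 hf), map_sum]
  simp only [intComponent_pderiv, hz]
  rw [mul_comm f]
  congr 1
  have hN' : IsHomogeneousInt (N : Poly k n) 0 := by
    rw [← map_natCast (C : RatFunc k →+* Poly k n)]
    exact isHomogeneousInt_natCast.2 (isHomogeneous_C _ _)
  rw [intComponent_mul hN', intComponent_sum_mul_pderiv hf]
  congr 1
  refine Finset.sum_congr rfl fun i _ => ?_
  rw [← hz]
  congr 3
  ring

/-- The prime factors of the denominator of `F` divide `f`, so the denominators of the certificates
divide powers of `f`. -/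
theorem IsRegularTelescoper.apply_mem (hf : f.IsHomogeneous d) (hf0 : f ≠ 0) {F : Frac k n}
    (hF : F ∈ homogeneousFractions f d (-(n : ℤ) - 1)) {T : DiffOp k}
    (h : IsRegularTelescoper F T) : T.apply F ∈ exactFractions f d := by
  obtain ⟨-, A, hA, hden⟩ := h
  refine mem_exactFractions_of_overPow hf hf0 (apply_mem_homogeneousFractions hf hf0 hF T)
    (fun i => ?_) hA
  obtain ⟨l, a, -, rfl⟩ := hF
  obtain ⟨N, hN⟩ := exists_dvd_pow_of_irreducible (f := f)
    (IsFractionRing.den (Poly k n) (A i) : Poly k n) (nonZeroDivisors.coe_ne_zero _)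
    fun p hp hd => (UniqueFactorizationMonoid.irreducible_iff_prime.1 hp).dvd_of_dvd_pow
      ((hden i p hp hd).trans (den_dvd_pow hf0 a l))
  exact ⟨N, exists_overPow_of_den_dvd hf0 hN⟩

theorem isRegularTelescoper_of_mem_exactFractions (hf0 : f ≠ 0) {F : Frac k n}
    (hden : ∀ p : Poly k n, Irreducible p → p ∣ f →
      p ∣ (IsFractionRing.den (Poly k n) F : Poly k n)) {T : DiffOp k} (hT : T ≠ 0)
    (h : T.apply F ∈ exactFractions f d) : IsRegularTelescoper F T := by
  obtain ⟨A, hA, e⟩ := h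
  refine ⟨hT, A, e, fun i p hp hd => hden p hp ?_⟩
  obtain ⟨l, a, -, h⟩ := hA i
  rw [h] at hd
  exact (UniqueFactorizationMonoid.irreducible_iff_prime.1 hp).dvd_of_dvd_pow
    (hd.trans (den_dvd_pow hf0 a l))

variable {f₁ f₂ : Poly k n} {d₁ d₂ : ℕ}

theorem mem_homogeneousFractions_of_isRelPrime
    (hf₂ : f₂.IsHomogeneous d₂) (hf0 : f₁ * f₂ ≠ 0) {z : ℤ} {F : Frac k n}
    (hF : F ∈ homogeneousFractions (f₁ * f₂) (d₁ + d₂) z)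
    (h : IsRelPrime f₂ (IsFractionRing.den (Poly k n) F : Poly k n)) :
    F ∈ homogeneousFractions f₁ d₁ z := by
  have hf₁0 := left_ne_zero_of_mul hf0
  have hf₂0 := right_ne_zero_of_mul hf0
  obtain ⟨l, a, ha, e⟩ := hF
  have h1 : (IsFractionRing.den (Poly k n) F : Poly k n) ∣ f₁ ^ l := by
    refine (h.symm.pow_right (n := l)).dvd_of_dvd_mul_right ?_
    rw [← mul_pow, e]
    exact den_dvd_pow hf0 a l
  obtain ⟨a₁, ha₁⟩ := exists_overPow_of_den_dvd hf₁0 h1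
  refine ⟨l, a₁, ?_, ha₁⟩
  have e1 : a = f₂ ^ l * a₁ := by
    rw [← overPow_inj hf0 (l := l), ← e, ha₁]
    unfold overPow
    rw [map_mul, map_pow, map_mul, mul_pow, mul_comm (algebraMap _ _ f₁ ^ l),
      mul_div_mul_left _ _ (pow_ne_zero l (algebraMap_frac_ne_zero hf₂0))]
  have e2 := ha.intComponent_eq
  rw [e1, intComponent_mul (IsHomogeneousInt.pow hf₂ l)] at e2
  rw [← mul_left_cancel₀ (pow_ne_zero l hf₂0) e2]
  convert isHomogeneousInt_intComponent (k := k) (n := n) _ _ using 1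
  push_cast
  ring

/-- In one variable the certificate has degree zero, so Euler's identity shows that its derivative
vanishes. -/
theorem exactFractions_eq_zero {f : Poly k 0} (hf : f.IsHomogeneous d) (hf0 : f ≠ 0)
    {G : Frac k 0} (hG : G ∈ exactFractions f d) : G = 0 := by
  obtain ⟨s, b, hb, rfl⟩ := exists_isExactAt hf hf0 hG
  have h1 := (hb 0).sum_X_mul_pderiv
  have h2 := (isHomogeneousInt_natCast.2 hf).sum_X_mul_pderiv
  rw [sum_dx_overPow hf0]
  simp only [Fin.sum_univ_succ, Finset.univ_eq_empty, Finset.sum_empty, add_zero] at h1 h2 ⊢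
  have : pderiv 0 (b 0) * f - s * (b 0 * pderiv 0 f) = 0 := by
    apply mul_left_cancel₀ (X_ne_zero (R := RatFunc k) (0 : Fin 1))
    push_cast at h1 h2
    linear_combination f * h1 - s * b 0 * h2
  rw [this, overPow_zero]

/-- In at least three variables, a form whose partial derivatives have no common zero is not a
product of two nonconstant forms. -/
theorem degree_eq_zero_of_mul (hn : 2 ≤ n) (hf₁ : f₁.IsHomogeneous d₁)
    (hf₂ : f₂.IsHomogeneous d₂)
    (hreg : Module.Finite (RatFunc k) (Poly k n ⧸ jacobianIdeal (f₁ * f₂))) :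
    d₁ = 0 ∨ d₂ = 0 := by
  by_contra! hd
  obtain ⟨N, hN⟩ := exists_X_pow_mem_jacobianIdeal (hf₁.mul hf₂) hreg
  let i₁ : Fin (n + 1) := 0
  let i₂ : Fin (n + 1) := ⟨1, by omega⟩
  let i₃ : Fin (n + 1) := ⟨2, by omega⟩
  have h21 : i₂ ≠ i₁ := by simp [i₁, i₂, Fin.ext_iff]
  have h31 : i₃ ≠ i₁ := by simp [i₁, i₃, Fin.ext_iff]
  have h32 : i₃ ≠ i₂ := by simp [i₂, i₃]
  -- By the product rule the Jacobian ideal lies in `(f₁, f₂)`. Padding with zeros gives `n + 1`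
  -- polynomials, as the syzygy theorem requires.
  let g : Fin (n + 1) → Poly k n := fun i => if i = i₁ then f₁ else if i = i₂ then f₂ else 0
  have hle : jacobianIdeal (f₁ * f₂) ≤ Ideal.span (Set.range g) := by
    refine Ideal.span_le.2 ?_
    rintro _ ⟨i, rfl⟩
    have h1 : f₁ ∈ Ideal.span (Set.range g) := Ideal.subset_span ⟨i₁, by simp [g]⟩
    have h2 : f₂ ∈ Ideal.span (Set.range g) := Ideal.subset_span ⟨i₂, by simp [g, h21]⟩
    change pderiv i (f₁ * f₂) ∈ Ideal.span (Set.range g)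
    rw [pderiv_mul]
    exact add_mem (Ideal.mul_mem_left _ _ h2) (Ideal.mul_mem_right _ _ h1)
  -- The unit vector at `i₃`, where `g` is zero, is a syzygy. If it were trivial, then `1` would be
  -- a combination of `f₁` and `f₂`, whose constant terms vanish.
  obtain ⟨h, -, -, h3⟩ := exists_alternating_of_syzygy g (fun j => hle (hN j))
    (Pi.single i₃ 1) (by
      rw [Finset.sum_eq_single i₃]
      · simp [g, h31, h32]
      · intro j _ hj
        simp [Pi.single_eq_of_ne hj]
      · simp)
  have h4 := congrArg constantCoeff (h3 i₃)
  have hg (j) : constantCoeff (g j) = 0 := by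
    have h1 : constantCoeff f₁ = 0 := hf₁.coeff_eq_zero (by simpa using hd.1.symm)
    have h2 : constantCoeff f₂ = 0 := hf₂.coeff_eq_zero (by simpa using hd.2.symm)
    simp only [g]
    split_ifs <;> simp [h1, h2]
  simp [hg] at h4

/-! ### Binary forms -/

theorem finrank_homogeneousInt_one (e : ℕ) :
    Module.finrank (RatFunc k) (homogeneousInt k 1 ((e : ℤ) - 1)) = e := by
  let s (j : Fin e) : Fin 2 →₀ ℕ := Finsupp.single 0 j.1 + Finsupp.single 1 (e - 1 - j.1)
  have hs (j : Fin e) : ((s j).degree : ℤ) = (e : ℤ) - 1 := by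
    have := j.2
    simp only [s, map_add, Finsupp.degree_single]
    omega
  have hs0 (j : Fin e) : s j 0 = j := by simp [s]
  let φ : homogeneousInt k 1 ((e : ℤ) - 1) →ₗ[RatFunc k] (Fin e → RatFunc k) :=
    LinearMap.pi fun j => (lcoeff (RatFunc k) (s j)).comp (Submodule.subtype _)
  have hφ : Function.Bijective φ := by
    constructor
    · rw [injective_iff_map_eq_zero]
      rintro ⟨p, hp⟩ h
      ext u
      by_contra hu
      have h1 := isHomogeneousInt_iff.1 hp u hu
      have h2 : u.degree = u 0 + u 1 := by
        rw [Finsupp.degree_eq_sum, Fin.sum_univ_two]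
      have h3 : u 0 < e := by omega
      have h4 : u = s ⟨u 0, h3⟩ := by
        ext i
        fin_cases i
        · simp [s]
        · simp [s]
          omega
      apply hu
      have h5 := congrFun h ⟨u 0, h3⟩
      rw [h4]
      exact h5
    · intro c
      refine ⟨⟨∑ j, monomial (s j) (c j), IsHomogeneousInt.sum fun j _ => ?_⟩, ?_⟩
      · rw [isHomogeneousInt_iff]
        intro u hu
        rw [coeff_monomial] at hu
        split_ifs at hu with h
        · rw [← h, hs]
        · simp at hu
      · funext j
        change coeff (s j) (∑ i, monomial (s i) (c i)) = c j
        rw [coeff_sum, Finset.sum_eq_single j]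
        · simp
        · intro i _ hij
          rw [coeff_monomial, if_neg]
          intro h
          have := congrFun (congrArg (⇑) h) 0
          rw [hs0, hs0] at this
          exact hij (Fin.ext this)
        · simp
  rw [(LinearEquiv.ofBijective φ hφ).finrank_eq]
  simp

/-- The map `(u, v) ↦ u g₂ + v g₁` is injective: in a relation `g₁` divides `u`, which has smaller
degree. Binary forms of degree `e - 1` have dimension `e`, so source and target both have dimension
`e₁ + e₂`. -/
theorem exists_partialFraction {g₁ g₂ b : Poly k 1} {e₁ e₂ : ℕ} (hg₁ : g₁.IsHomogeneous e₁)
    (hg₂ : g₂.IsHomogeneous e₂) (hg₁0 : g₁ ≠ 0) (h : IsRelPrime g₁ g₂)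
    (hb : IsHomogeneousInt b ((e₁ + e₂ : ℕ) - 1)) :
    ∃ u v, IsHomogeneousInt u ((e₁ : ℤ) - 1) ∧ IsHomogeneousInt v ((e₂ : ℤ) - 1) ∧
      b = u * g₂ + v * g₁ := by
  have h1 := isHomogeneousInt_natCast.2 hg₁
  have h2 := isHomogeneousInt_natCast.2 hg₂
  let φ : homogeneousInt k 1 ((e₁ : ℤ) - 1) × homogeneousInt k 1 ((e₂ : ℤ) - 1) →ₗ[RatFunc k]
      homogeneousInt k 1 ((e₁ + e₂ : ℕ) - 1) :=
    { toFun := fun x => ⟨x.1.1 * g₂ + x.2.1 * g₁,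
        IsHomogeneousInt.add
          (by convert IsHomogeneousInt.mul x.1.2 h2 using 1; push_cast; ring)
          (by convert IsHomogeneousInt.mul x.2.2 h1 using 1; push_cast; ring)⟩
      map_add' := fun x y => Subtype.ext (by simp; ring)
      map_smul' := fun c x => Subtype.ext (by simp) }
  have hinj : Function.Injective φ := by
    rw [injective_iff_map_eq_zero]
    rintro ⟨⟨u, hu⟩, ⟨v, hv⟩⟩ h0
    have h0' : u * g₂ + v * g₁ = 0 := congrArg Subtype.val h0
    have hdvd : g₁ ∣ u := h.dvd_of_dvd_mul_right ⟨-v, by linear_combination h0'⟩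
    obtain ⟨c, rfl⟩ := hdvd
    have hc := IsHomogeneousInt.intComponent_eq hu
    rw [intComponent_mul h1, (isHomogeneousInt_intComponent _ c).eq_zero (by omega),
      mul_zero] at hc
    rw [← hc, zero_mul, zero_add] at h0'
    have hv0 := (mul_eq_zero.1 h0').resolve_right hg₁0
    ext1
    · exact Subtype.ext hc.symm
    · exact Subtype.ext hv0
  have hsurj : Function.Surjective φ := by
    rw [← LinearMap.injective_iff_surjective_of_finrank_eq_finrank]
    · exact hinj
    · rw [Module.finrank_prod, finrank_homogeneousInt_one, finrank_homogeneousInt_one,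
        finrank_homogeneousInt_one]
  obtain ⟨⟨u, v⟩, huv⟩ := hsurj ⟨b, hb⟩
  exact ⟨u, v, u.2, v.2, (congrArg Subtype.val huv).symm⟩

/-- A function with poles allowed along both of two coprime denominators separately is a polynomial,
and its degree is negative. -/
theorem eq_zero_of_mem_homogeneousFractions_of_isRelPrime (hf₁ : f₁.IsHomogeneous d₁)
    (hf₁0 : f₁ ≠ 0) (hf₂0 : f₂ ≠ 0) (h : IsRelPrime f₁ f₂) {z : ℤ} (hz : z < 0) {G : Frac k n}
    (h1 : G ∈ homogeneousFractions f₁ d₁ z) (h2 : G ∈ homogeneousFractions f₂ d₂ z) : G = 0 := by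
  obtain ⟨l, a, ha, rfl⟩ := h1
  obtain ⟨l', a', -, e⟩ := h2
  unfold overPow at e
  rw [div_eq_div_iff (pow_ne_zero _ (algebraMap_frac_ne_zero hf₁0))
    (pow_ne_zero _ (algebraMap_frac_ne_zero hf₂0)), ← map_pow, ← map_pow, ← map_mul,
    ← map_mul] at e
  have e := IsFractionRing.injective (Poly k n) (Frac k n) e
  have hdvd : f₁ ^ l ∣ a := (h.pow (m := l) (n := l')).dvd_of_dvd_mul_right
    ⟨a', by rw [e, mul_comm]⟩
  obtain ⟨c, rfl⟩ := hdvd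
  have hc := ha.intComponent_eq
  rw [intComponent_mul (IsHomogeneousInt.pow hf₁ l),
    (isHomogeneousInt_intComponent _ c).eq_zero (by linarith), mul_zero] at hc
  rw [← hc, overPow_zero]

/-- Each certificate splits into a part over a power of `f₁` and a part over a power of `f₂`. The
derivatives of the `f₂`-parts add up to the difference of two functions with denominators in `f₁`,
so this sum is zero and the `f₁`-parts suffice. -/
theorem mem_exactFractions_of_isRelPrime {f₁ f₂ : Poly k 1} (hf₁ : f₁.IsHomogeneous d₁)
    (hf₂ : f₂.IsHomogeneous d₂) (hf₁0 : f₁ ≠ 0) (hf₂0 : f₂ ≠ 0) (h : IsRelPrime f₁ f₂)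
    {G : Frac k 1} (hG : G ∈ exactFractions (f₁ * f₂) (d₁ + d₂))
    (hG₁ : G ∈ homogeneousFractions f₁ d₁ (-2)) : G ∈ exactFractions f₁ d₁ := by
  have hf0 := mul_ne_zero hf₁0 hf₂0
  obtain ⟨s, b, hb, e⟩ := exists_isExactAt (hf₁.mul hf₂) hf0 hG
  have hpf (i) : ∃ u v, IsHomogeneousInt u (-((1 : ℕ) : ℤ) + s * d₁) ∧
      IsHomogeneousInt v (-((1 : ℕ) : ℤ) + s * d₂) ∧
      overPow (f₁ * f₂) (b i) s = overPow f₁ u s + overPow f₂ v s := by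
    obtain ⟨u, v, hu, hv, huv⟩ := exists_partialFraction (hf₁.pow s) (hf₂.pow s)
      (pow_ne_zero s hf₁0) (h.pow (m := s) (n := s)) (b := b i)
      (by convert hb i using 1; push_cast; ring)
    refine ⟨u, v, by convert hu using 1; push_cast; ring, by convert hv using 1; push_cast; ring,
      ?_⟩
    have h1 := pow_ne_zero s (algebraMap_frac_ne_zero hf₁0)
    have h2 := pow_ne_zero s (algebraMap_frac_ne_zero hf₂0)
    unfold overPow
    rw [huv, div_add_div _ _ h1 h2, map_add, map_mul, map_mul, map_mul, map_pow, map_pow, mul_pow,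
      mul_comm (algebraMap _ _ v)]
  choose u v hu hv huv using hpf
  have hH : ∑ i, dx k 1 i (overPow f₁ (u i) s) ∈ exactFractions f₁ d₁ :=
    IsExactAt.mem ⟨u, hu, rfl⟩
  have hdeg {f : Poly k 1} {d : ℕ} (hf : f.IsHomogeneous d) (hf0 : f ≠ 0)
      {w : Fin (1 + 1) → Poly k 1} (hw : ∀ i, IsHomogeneousInt (w i) (-((1 : ℕ) : ℤ) + s * d)) :
      ∑ i, dx k 1 i (overPow f (w i) s) ∈ homogeneousFractions f d (-2) := by
    refine (fractionSubmodule hf hf0 (-2)).sum_mem fun i _ => ⟨s + 1, _, ?_, dx_overPow hf0 i _ s⟩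
    have hf' := isHomogeneousInt_natCast.2 hf
    have h1 := hf'.mul ((hw i).pderiv i)
    have h2 := ((hw i).C_mul s).mul (hf'.pderiv i)
    rw [map_natCast] at h2
    convert h1.sub (by convert h2 using 1; ring) using 1
    push_cast
    ring
  have e' : G = ∑ i, dx k 1 i (overPow f₁ (u i) s) + ∑ i, dx k 1 i (overPow f₂ (v i) s) := by
    rw [e, ← Finset.sum_add_distrib]
    exact Finset.sum_congr rfl fun i _ => by rw [huv, map_add]
  have h0 : ∑ i, dx k 1 i (overPow f₂ (v i) s) = 0 := by
    refine eq_zero_of_mem_homogeneousFractions_of_isRelPrime hf₁ hf₁0 hf₂0 h (z := -2)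
      (by norm_num) ?_ (hdeg hf₂ hf₂0 hv)
    have := (fractionSubmodule hf₁ hf₁0 (-2)).sub_mem hG₁ (hdeg hf₁ hf₁0 hu)
    rwa [e', add_sub_cancel_left] at this
  rw [e', h0, add_zero]
  exact hH

theorem isRegularTelescoper_of_apply_eq_zero {F : Frac k n} {T : DiffOp k} (hT : T ≠ 0)
    (h : T.apply F = 0) : IsRegularTelescoper F T := by
  refine ⟨hT, 0, by simp [h], fun i p hp hd => ?_⟩
  exact absurd (isUnit_of_dvd_unit hd (IsFractionRing.isUnit_den_zero (A := Poly k n)))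
    hp.not_isUnit

theorem isUnit_of_isHomogeneous_zero (hf : f.IsHomogeneous 0) (hf0 : f ≠ 0) : IsUnit f := by
  rw [← totalDegree_zero_iff_isHomogeneous, totalDegree_eq_zero_iff_eq_C] at hf
  rw [hf] at hf0 ⊢
  exact (isUnit_iff_ne_zero.2 fun h => hf0 (by rw [h, C_0])).map C

/-- From right to left the certificate may have poles along `f₂`, the part of `f` coprime to the
denominator of `F`. These are removed separately for `n = 0`, `n = 1` and `n ≥ 2`. -/
theorem isRegularTelescoper_iff (hf : f.IsHomogeneous d)
    (hreg : Module.Finite (RatFunc k) (Poly k n ⧸ jacobianIdeal f)) {F : Frac k n}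
    (hF : F ∈ homogeneousFractions f d (-(n : ℤ) - 1)) (T : DiffOp k) :
    IsRegularTelescoper F T ↔ T ≠ 0 ∧ T.apply F ∈ exactFractions f d := by
  have hf0 := ne_zero_of_finite hf hreg
  refine ⟨fun h => ⟨h.1, h.apply_mem hf hf0 hF⟩, fun ⟨hT, h⟩ => ?_⟩
  by_cases hn : n = 0
  · subst hn
    exact isRegularTelescoper_of_apply_eq_zero hT (exactFractions_eq_zero hf hf0 h)
  obtain ⟨f₁, f₂, rfl, hden, hrel⟩ :=
    exists_eq_mul_isRelPrime (IsFractionRing.den (Poly k n) F : Poly k n) f hf0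
  have hf₁0 := left_ne_zero_of_mul hf0
  have hf₂0 := right_ne_zero_of_mul hf0
  obtain ⟨d₁, hf₁⟩ := isHomogeneous_of_mul_left hf hf0
  obtain ⟨d₂, hf₂⟩ := isHomogeneous_of_mul_left (p := f₂) (q := f₁) (by rwa [mul_comm])
    (by rwa [mul_comm])
  obtain rfl := hf.inj_right (hf₁.mul hf₂) hf0
  have hF₁ := mem_homogeneousFractions_of_isRelPrime hf₂ hf0 hF hrel
  by_cases hn1 : n = 1
  · subst hn1
    refine isRegularTelescoper_of_mem_exactFractions hf₁0 hden hT
      (mem_exactFractions_of_isRelPrime hf₁ hf₂ hf₁0 hf₂0 ?_ h ?_)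
    · intro c h1 h2
      by_contra hc
      obtain ⟨p, hp, hpc⟩ := WfDvdMonoid.exists_irreducible_factor hc (ne_zero_of_dvd_ne_zero hf₁0 h1)
      exact hp.not_isUnit (hrel (hpc.trans h2) (hden p hp (hpc.trans h1)))
    · exact apply_mem_homogeneousFractions hf₁ hf₁0 hF₁ T
  -- If `f₁` is constant, `F` is a polynomial of negative degree and vanishes; if `f₂` is constant,
  -- every prime factor of `f` divides the denominator of `F`.
  · rcases degree_eq_zero_of_mul (by omega) hf₁ hf₂ hreg with rfl | rfl
    · obtain ⟨l, a, ha, e⟩ := hF₁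
      rw [ha.eq_zero (by push_cast; omega), overPow_zero] at e
      refine isRegularTelescoper_of_apply_eq_zero hT ?_
      rw [e]
      refine Finset.sum_eq_zero fun j _ => ?_
      change T j • (dt k n)^[j] 0 = 0
      rw [Function.iterate_fixed (map_zero _), smul_zero]
    · refine isRegularTelescoper_of_mem_exactFractions hf0 (fun p hp hd => ?_) hT h
      rcases (UniqueFactorizationMonoid.irreducible_iff_prime.1 hp).dvd_or_dvd hd with h1 | h1
      · exact hden p hp h1
      · exact absurd (isUnit_of_dvd_unit h1 (isUnit_of_isHomogeneous_zero hf₂ hf₂0)) hp.not_isUnit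

end Regular

/-! ### Operators -/

section Operators

variable {k : Type*} [Field k] {n : ℕ}

theorem DiffOp.apply_eq_linearCombination (T : DiffOp k) (F : Frac k n) :
    T.apply F = Finsupp.linearCombination (RatFunc k) (fun j => (dt k n)^[j] F) T :=
  rfl

theorem DiffOp.apply_sub_smul (S T : DiffOp k) (c : RatFunc k) (F : Frac k n) :
    DiffOp.apply (S - c • T) F = S.apply F - c • T.apply F := by
  simp only [DiffOp.apply_eq_linearCombination, map_sub, map_smul]

theorem DiffOp.eq_zero_of_order_lt {T : DiffOp k} {j : ℕ} (h : T.order < j) : T j = 0 := by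
  by_contra hj
  exact absurd (Finset.le_sup (f := id) (Finsupp.mem_support_iff.2 hj)) (not_le.2 h)

theorem DiffOp.order_lt {T : DiffOp k} {i : ℕ} (h : ∀ j, i ≤ j → T j = 0) (hT : T ≠ 0) :
    T.order < i := by
  obtain ⟨j, hj⟩ := Finsupp.support_nonempty_iff.2 hT
  have hlt : ∀ j ∈ T.support, j < i := fun j hj => by
    by_contra! hij
    exact Finsupp.mem_support_iff.1 hj (h j hij)
  exact (Finset.sup_lt_iff (f := id) (lt_of_le_of_lt (Nat.zero_le j) (hlt j hj))).2 hlt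

theorem DiffOp.order_eq {T : DiffOp k} {i : ℕ} (hi : T i ≠ 0) (h : ∀ j, i < j → T j = 0) :
    T.order = i := by
  apply le_antisymm
  · exact Nat.lt_succ_iff.1 (DiffOp.order_lt (fun j hj => h j hj) fun h0 => hi (by rw [h0]; rfl))
  · exact Finset.le_sup (f := id) (Finsupp.mem_support_iff.2 hi)

/-- The elements `G j` represent the derivatives `∂ₜʲF` modulo `D`. -/
theorem DiffOp.apply_mem_iff {D N : Submodule (RatFunc k) (Frac k n)} (hDN : Disjoint D N)
    {F : Frac k n} {i : ℕ} {G : Fin i → Frac k n}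
    (hG : ∀ j, G j ∈ N ∧ G j - (dt k n)^[j] F ∈ D) {S : DiffOp k} (hS : ∀ j, i ≤ j → S j = 0) :
    S.apply F ∈ D ↔ ∑ j : Fin i, S j • G j = 0 := by
  have h1 : S.apply F = ∑ j : Fin i, S j • (dt k n)^[j] F := by
    rw [Fin.sum_univ_eq_sum_range (fun j => S j • (dt k n)^[j] F) i]
    refine Finsupp.sum_of_support_subset _ (fun j hj => ?_) _ fun _ _ => zero_smul _ _
    rw [Finset.mem_range]
    by_contra! h
    exact Finsupp.mem_support_iff.1 hj (hS j h)
  have h2 : ∑ j : Fin i, S j • G j - S.apply F ∈ D := by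
    rw [h1, ← Finset.sum_sub_distrib]
    exact D.sum_mem fun j _ => by
      rw [← smul_sub]
      exact D.smul_mem _ (hG j).2
  constructor
  · intro h
    have h3 := D.add_mem h2 h
    rw [sub_add_cancel] at h3
    exact Submodule.disjoint_def.1 hDN _ h3 (N.sum_mem fun j _ => N.smul_mem _ (hG j).1)
  · intro h
    rw [h, zero_sub] at h2
    exact D.neg_mem_iff.1 h2

end Operators

/-! ### The algorithm -/

section Algorithm

variable {k : Type*} [Field k] {n : ℕ}

/-- The invariant of the algorithm, for the spaces `D` of exact functions and `N` of normal
forms. -/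
def State.Invariant (f : Poly k n) (d : ℕ) (D N : Submodule (RatFunc k) (Frac k n))
    (F : Frac k n) : State k n → Prop
  | .start => True
  | .reduce i G acc l a =>
    (∀ j, G j ∈ N ∧ G j - (dt k n)^[j] F ∈ D) ∧ LinearIndependent (RatFunc k) G ∧ acc ∈ N ∧
      1 ≤ l ∧ IsHomogeneousInt a ((l : ℤ) * d - (n + 1)) ∧
      acc + overPow f a l - (dt k n)^[i] F ∈ D
  | .loop _ G =>
    (∀ j, G j ∈ N ∧ G j - (dt k n)^[j] F ∈ D) ∧
      LinearIndependent (RatFunc k) fun j : Fin _ => G (Fin.castSucc j)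
  | .done T =>
    T ≠ 0 ∧ T.apply F ∈ D ∧ T T.order = 1 ∧
      ∀ S : DiffOp k, S ≠ 0 → S.apply F ∈ D → T.order ≤ S.order

/-- The quantity that decreases with every step, where `r` is the dimension of the space of normal
forms. -/
def State.measure (r : ℕ) : State k n → ℕ ×ₗ ℕ
  | .start => toLex (r + 3, 0)
  | .reduce i _ _ l _ => toLex (r + 2 - i, l)
  | .loop i _ => toLex (r + 2 - i, 0)
  | .done _ => toLex (0, 0)

variable {d : ℕ} {f : Poly k n} {m : MonomialOrder (Fin (n + 1))} {B : Finset (Poly k n)}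
  {F : Frac k n} {D N : Submodule (RatFunc k) (Frac k n)}

theorem le_finrank_of_linearIndependent [Module.Finite (RatFunc k) N] {i : ℕ}
    {G : Fin i → Frac k n} (hG : ∀ j, G j ∈ N) (h : LinearIndependent (RatFunc k) G) :
    i ≤ Module.finrank (RatFunc k) N := by
  have h' : LinearIndependent (RatFunc k) fun j => (⟨G j, hG j⟩ : N) :=
    LinearIndependent.of_comp N.subtype h
  simpa using h'.fintype_card_le_finrank

theorem finrank_lt_iff {i : ℕ} (G : Fin (i + 1) → Frac k n) :
    Set.finrank (RatFunc k) (Set.range G) < i + 1 ↔ ¬ LinearIndependent (RatFunc k) G := by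
  rw [linearIndependent_iff_card_le_finrank_span, Fintype.card_fin, not_le]

/-- A pass through the loop head increases `i`, and a reduction decreases `l`. At the head `i`
independent elements of `N` are known, so `i` is at most the dimension of `N` and the truncated
difference really drops. -/
theorem Step.measure_lt [Module.Finite (RatFunc k) N] {s s' : State k n}
    (h : Step m B f d F s s') (hs : s.Invariant f d D N F) :
    s'.measure (Module.finrank (RatFunc k) N) < s.measure (Module.finrank (RatFunc k) N) := by
  cases h with
  | init l a h => simp [State.measure, Prod.Lex.toLex_lt_toLex]
  | reduceOne i G acc a => simp [State.measure, Prod.Lex.toLex_lt_toLex]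
  | reducePole i G acc l hl a r v h => simp [State.measure, Prod.Lex.toLex_lt_toLex]
  | finish i G hrank c hc =>
    have := le_finrank_of_linearIndependent (fun j => (hs.1 _).1) hs.2
    simp only [State.measure, Prod.Lex.toLex_lt_toLex]
    left
    omega
  | _ i G hrank l a h =>
    have := le_finrank_of_linearIndependent (fun j => (hs.1 _).1) hs.2
    simp only [State.measure, Prod.Lex.toLex_lt_toLex]
    left
    omega

theorem Step.invariant [CharZero k] (hf : f.IsHomogeneous d) (hf0 : f ≠ 0)
    (hDN : Disjoint (exactSubmodule hf hf0) N)
    (hN : ∀ l, 1 ≤ l → normalTerms d f m B l ≤ N) {s s' : State k n}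
    (h : Step m B f d F s s') (hs : s.Invariant f d (exactSubmodule hf hf0) N F) :
    s'.Invariant f d (exactSubmodule hf hf0) N F := by
  cases h with
  | init l a h =>
    obtain ⟨h1, h2, h3⟩ := h
    refine ⟨fun j => j.elim0, linearIndependent_empty_type, zero_mem _, h1, h2, ?_⟩
    rw [zero_add, Function.iterate_zero, id, ← h3, sub_self]
    exact zero_mem _
  | reduceOne i G acc a =>
    obtain ⟨h1, h2, h3, -, h5, h6⟩ := hs
    refine ⟨fun j => ?_, by simpa using h2⟩
    refine Fin.lastCases ?_ (fun j => ?_) j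
    · rw [Fin.snoc_last]
      exact ⟨N.add_mem h3 (hN 1 le_rfl (mem_normalTerms.2 ⟨a, h5, fun h => absurd rfl h, rfl⟩)),
        h6⟩
    · rw [Fin.snoc_castSucc]
      exact h1 j
  | reducePole i G acc l hl a r v h =>
    obtain ⟨h1, h2, h3, -, h5, h6⟩ := hs
    have h7 := sub_mem_exactFractions_of_isDecomposition hf0 hl h
    obtain ⟨h8, h9, h10, h11⟩ := h
    refine ⟨h1, h2, N.add_mem h3 (hN (l + 1) (by omega)
      (mem_normalTerms.2 ⟨r, h10, fun _ => h9, rfl⟩)), hl, ?_, ?_⟩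
    · refine .C_mul _ (.sum fun j _ => ?_)
      convert (h11 j).pderiv j using 1
      push_cast
      ring
    · convert (exactSubmodule hf hf0).add_mem h6 h7 using 1
      abel
  | finish i G hrank c hc =>
    obtain ⟨h1, h2⟩ := hs
    set T : DiffOp k := Finsupp.single i 1 - ∑ j : Fin i, Finsupp.single (j : ℕ) (c j) with hT
    have hTge (j : ℕ) (hj : i ≤ j) : T j = Finsupp.single i (1 : RatFunc k) j := by
      rw [hT, Finsupp.sub_apply, Finsupp.finsetSum_apply, Finset.sum_eq_zero, sub_zero]
      intro l _
      exact Finsupp.single_eq_of_ne (by omega)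
    have hTi : T i = 1 := by rw [hTge i le_rfl, Finsupp.single_eq_same]
    have hTgt (j : ℕ) (hj : i + 1 ≤ j) : T j = 0 := by
      rw [hTge j (by omega), Finsupp.single_eq_of_ne (by omega)]
    have hTlt (j : Fin i) : T j = -c j := by
      rw [hT, Finsupp.sub_apply, Finsupp.finsetSum_apply, Finsupp.single_eq_of_ne (by omega),
        zero_sub, Finset.sum_eq_single j]
      · rw [Finsupp.single_eq_same]
      · intro l _ hl
        exact Finsupp.single_eq_of_ne fun h => hl (Fin.ext h.symm)
      · simp
    have hord : T.order = i := DiffOp.order_eq (by rw [hTi]; exact one_ne_zero) hTgt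
    refine ⟨fun h0 => ?_, ?_, by rw [hord, hTi], fun S hS0 hS => ?_⟩
    · rw [h0] at hTi
      exact zero_ne_one hTi
    · rw [DiffOp.apply_mem_iff hDN h1 hTgt, Fin.sum_univ_castSucc]
      simp only [Fin.val_castSucc, hTlt, Fin.val_last, hTi, one_smul, neg_smul,
        Finset.sum_neg_distrib, hc, neg_add_cancel]
    · rw [hord]
      by_contra! hlt
      have hge (j : ℕ) (hj : i ≤ j) : S j = 0 := DiffOp.eq_zero_of_order_lt (by omega)
      rw [DiffOp.apply_mem_iff hDN (fun j => h1 j.castSucc) hge] at hS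
      -- An operator of smaller order would be a relation among `G 0, …, G (i - 1)`, which are
      -- independent.
      have h3 := Fintype.linearIndependent_iff.1 h2 (fun j => S j) hS
      apply hS0
      ext1 j
      by_cases hj : j < i
      · exact h3 ⟨j, hj⟩
      · exact hge j (by omega)
  | _ i G hrank l a h =>
    obtain ⟨h1, h2⟩ := hs
    obtain ⟨h3, h4, h5⟩ := h
    rw [finrank_lt_iff, not_not] at hrank
    refine ⟨h1, hrank, zero_mem _, h3, h4, ?_⟩
    rw [zero_add, ← h5, Function.iterate_succ_apply', ← map_sub]
    exact dt_mem_exactFractions hf hf0 (h1 (Fin.last i)).2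

theorem exists_step (hf : f.IsHomogeneous d) (hB : IsGroebnerBasis m B (jacobianIdeal f))
    (hf0 : f ≠ 0) (hF : F ∈ homogeneousFractions f d (-(n : ℤ) - 1))
    (hN : ∀ G ∈ N, G ∈ homogeneousFractions f d (-(n : ℤ) - 1)) {s : State k n}
    (hs : s.Invariant f d D N F) : (∃ T, s = .done T) ∨ ∃ s', Step m B f d F s s' := by
  match s, hs with
  | .start, _ =>
    obtain ⟨l, a, h⟩ := exists_isWrittenAs hf hf0 hF
    exact Or.inr ⟨_, .init l a h⟩
  | .reduce i G acc l a, hs =>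
    obtain ⟨-, -, -, h4, h5, -⟩ := hs
    obtain ⟨l, rfl⟩ := Nat.exists_eq_add_of_le' h4
    rcases Nat.eq_zero_or_pos l with rfl | hl
    · exact Or.inr ⟨_, .reduceOne i G acc a⟩
    · obtain ⟨r, v, h⟩ := exists_isDecomposition hf hB h5
      exact Or.inr ⟨_, .reducePole i G acc l hl a r v h⟩
  | .loop i G, hs =>
    obtain ⟨h1, h2⟩ := hs
    by_cases hrank : Set.finrank (RatFunc k) (Set.range G) < i + 1
    · have hli := (finrank_lt_iff G).1 hrank
      -- The first `i` elements are independent, so a rank drop puts the last one into their span: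
      -- the linear system is solvable.
      rw [linearIndependent_finSucc', not_and, not_not] at hli
      obtain ⟨c, hc⟩ := (Submodule.mem_span_range_iff_exists_fun _).1 (hli h2)
      exact Or.inr ⟨_, .finish i G hrank c hc⟩
    · obtain ⟨l, a, h⟩ := exists_isWrittenAs hf hf0
        (dt_mem_homogeneousFractions hf hf0 (hN _ (h1 (Fin.last i)).1))
      exact Or.inr ⟨_, .continue i G hrank l a h⟩
  | .done T, _ => exact Or.inl ⟨T, rfl⟩

end Algorithm

end Telescoping

end

/-! ### Termination, minimality and uniqueness -/

theorem mainTheorem6 {k : Type*} [Field k] [CharZero k] (n d : ℕ)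
    (f : Telescoping.Poly k n) (hf : f.IsHomogeneous d)
    (hreg : Module.Finite (RatFunc k) (Telescoping.Poly k n ⧸ Telescoping.jacobianIdeal f))
    (m : MonomialOrder (Fin (n + 1))) (B : Finset (Telescoping.Poly k n))
    (hB : Telescoping.IsGroebnerBasis m B (Telescoping.jacobianIdeal f))
    (F : Telescoping.Frac k n)
    (hF : F ∈ Telescoping.homogeneousFractions f d (-(n : ℤ) - 1)) :
    Telescoping.Terminates m B f d F ∧
      ∀ T : Telescoping.DiffOp k, Telescoping.Reaches m B f d F (.done T) →
        Telescoping.IsOfMinimalOrder (Telescoping.IsRegularTelescoper F) T ∧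
        Telescoping.IsOfMinimalOrder
          (fun S => S ≠ 0 ∧ S.apply F ∈ Telescoping.exactFractions f d) T ∧
        T T.order = 1 ∧
        ∀ S : Telescoping.DiffOp k,
          Telescoping.IsOfMinimalOrder (Telescoping.IsRegularTelescoper F) S →
            ∃ c : RatFunc k, S = c • T := by
  have hf0 := Telescoping.ne_zero_of_finite hf hreg
  obtain ⟨M, hM⟩ := Telescoping.exists_normalTerms_le hf hreg hB
  have hDN : Disjoint (Telescoping.exactSubmodule hf hf0) (Telescoping.normalForms d f m B M) :=
    Submodule.disjoint_def.2 fun G h1 h2 => Telescoping.eq_zero_of_mem_normalForms hf hreg hB h2 h1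
  have hinv {s : Telescoping.State k n} (h : Telescoping.Reaches m B f d F s) :
      s.Invariant f d (Telescoping.exactSubmodule hf hf0) (Telescoping.normalForms d f m B M)
        F := by
    induction h with
    | refl => trivial
    | tail _ hstep ih => exact hstep.invariant hf hf0 hDN hM ih
  refine ⟨⟨?_, fun s hs hstuck => ?_⟩, fun T hT => ?_⟩
  · rintro ⟨s, h0, hs⟩
    have hr (j) : Telescoping.Reaches m B f d F (s j) := by
      induction j with
      | zero =>
        rw [h0]
        exact .refl
      | succ j ih => exact ih.tail (hs j)
    exact not_strictAnti_of_wellFoundedLT (fun j => (s j).measure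
      (Module.finrank (RatFunc k) (Telescoping.normalForms d f m B M)))
      (strictAnti_nat_of_succ_lt fun j => (hs j).measure_lt (hinv (hr j)))
  · refine (Telescoping.exists_step hf hB hf0 hF (fun G hG => ?_) (hinv hs)).resolve_right
      fun ⟨s', h⟩ => hstuck s' h
    obtain ⟨a, ha, e⟩ := Telescoping.exists_overPow_of_mem_normalForms hf hf0 hG
    exact ⟨M, a, ha, e⟩
  · obtain ⟨h1, h2, h3, h4⟩ := hinv hT
    have hiff := Telescoping.isRegularTelescoper_iff hf hreg hF
    refine ⟨⟨(hiff T).2 ⟨h1, h2⟩, fun S hS => ?_⟩, ⟨⟨h1, h2⟩, fun S hS => h4 S hS.1 hS.2⟩, h3,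
      fun S ⟨hS, hmin⟩ => ⟨S T.order, ?_⟩⟩
    · obtain ⟨hS0, hS⟩ := (hiff S).1 hS
      exact h4 S hS0 hS
    · have hle := hmin T ((hiff T).2 ⟨h1, h2⟩)
      obtain ⟨hS0, hS⟩ := (hiff S).1 hS
      -- Subtracting the multiple of the monic `T` with the same coefficient at `∂ₜ ^ T.order`
      -- cancels the leading term. A nonzero difference would still map `F` into `D_f`, with order
      -- below the minimum.
      by_contra hne
      have hne' : S - S T.order • T ≠ 0 := sub_ne_zero.2 hne
      have hmem : Telescoping.DiffOp.apply (S - S T.order • T) F ∈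
          Telescoping.exactSubmodule hf hf0 := by
        rw [Telescoping.DiffOp.apply_sub_smul]
        exact Submodule.sub_mem _ hS (Submodule.smul_mem _ _ h2)
      refine absurd (h4 _ hne' hmem) (not_le.2 (Telescoping.DiffOp.order_lt (fun j hj => ?_) hne'))
      rw [Finsupp.sub_apply, Finsupp.smul_apply]
      rcases hj.eq_or_lt with rfl | hj
      · rw [h3, smul_eq_mul, mul_one, sub_self]
      · rw [Telescoping.DiffOp.eq_zero_of_order_lt hj,
          Telescoping.DiffOp.eq_zero_of_order_lt (hle.trans_lt hj), smul_zero, sub_zero]
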